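/- Conventions. Local rings are Noetherian. Let $p$ be a prime. A $p$-family of ideals in a ring $R$ of characteristic $p$ is a sequence $I_\bullet=\{I_q\}$ of ideals indexed by the powers $q=p^e$, $e\ge 0$, such that $I_q^{[p]}\subseteq I_{pq}$ for all $q$, where $J^{[p]}$ is the ideal generated by the $p$-th powers of the elements of $J$. For a local ring $(R,\mathfrak m)$ of characteristic $p$ and dimension $d$, and a $p$-family $I_\bullet$ of $\mathfrak m$-primary ideals, put $$\operatorname{vol}_R(I_\bullet)=\lim_{q\to\infty}\frac{\ell_R(R/I_q)}{q^{d}}$$ whenever this limit exists, where $\ell_R$ denotes length. A local domain $(D,\mathfrak m,\Bbbk)$ of dimension $d$ with fraction field $\mathbb F$ is an *OK domain* if there are a vector $\mathbf a\in\mathbb R^d$ with coordinates linearly independent over $\mathbb Q$, inducing the order $\mathbf u\le\mathbf v\iff\langle\mathbf a,\mathbf u\rangle\le\langle\mathbf a,\mathbf v\rangle$ on $\mathbb Z^d$, and a surjective group homomorphism $\nu:\mathbb F^\times\to\mathbb Z^d$ with $\nu(x+y)\ge\min(\nu(x),\nu(y))$ whenever $x+y\ne0$, with valuation ring $(V,\mathfrak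 m_V,\Bbbk_V)$, such that: 1. $D\subseteq V$, and the inclusion is a local homomorphism; 2. $\langle\mathbf a,\mathbf u\rangle>0$ for every nonzero $\mathbf u$ in the closed cone in $\mathbb R^d$ generated by $\nu(D\setminus\{0\})$; 3. the residue field extension $\Bbbk\hookrightarrow\Bbbk_V$ is finite; 4. there is $\mathbf v\in\mathbb Z^d$ such that $\{x\in D: x=0\text{ or }\nu(x)\ge n\mathbf v\}\subseteq\mathfrak m^n$ for all integers $n\ge0$. Proposition. Let $(R,\mathfrak m)$ be a reduced local ring of characteristic $p>0$ such that $R/\mathfrak p$ is an OK domain for every minimal prime $\mathfrak p$ of $R$, and let $I_\bullet$ be a $p$-family of $\mathfrak m$-primary ideals in $R$. Then the limit $\operatorname{vol}_R(I_\bullet)$ exists and is finite, the limit $\operatorname{vol}_{R/\mathfrak p}(I_\bullet\, R/\mathfrak p)$ exists and is finite for every minimal prime $\mathfrak p$ with $\dim R/\mathfrak p=\dim R$, and $$\operatorname{vol}_R(I_\bullet)=\sum_{\mathfrak p}\operatorname{vol}_{R/\mathfrak p}(I_\bullet\, R/\mathfrak p),$$ where the sum is over all minimal primes $\mathfrak p$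 of $R$ with $\dim R/\mathfrak p=\dim R$. -/

import Mathlib

open scoped NNReal Topology

noncomputable section

namespace OKVol

/-- The inclusion of `ℤ^d` into `ℝ^d`. -/
def toReal {d : ℕ} (u : Fin d → ℤ) : Fin d → ℝ := fun i => (u i : ℝ)

/-- A valuation on the field `F` with value group `ℤ^d`, where `ℤ^d` is ordered through the
`ℤ`-linear map `u ↦ ⟨a, u⟩` to `ℝ` (an embedding as soon as the coordinates of `a` are linearly
independent over `ℚ`): a surjective group homomorphism `Fˣ → ℤ^d` such that
`ν (x + y) ≥ min (ν x) (ν y)` whenever `x + y ≠ 0`. -/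
structure LatticeValuation (F : Type*) [Field F] (d : ℕ) (a : Fin d → ℝ) where
  /-- The underlying group homomorphism. -/
  hom : Fˣ →* Multiplicative (Fin d → ℤ)
  surjective_hom : Function.Surjective hom
  min_le_add : ∀ x y z : Fˣ, (z : F) = (x : F) + (y : F) →
    min (a ⬝ᵥ toReal (Multiplicative.toAdd (hom x)))
        (a ⬝ᵥ toReal (Multiplicative.toAdd (hom y))) ≤
      a ⬝ᵥ toReal (Multiplicative.toAdd (hom z))

namespace LatticeValuation

variable {F : Type*} [Field F] {d : ℕ} {a : Fin d → ℝ}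

/-- The value in `ℤ^d` of a nonzero element of the field. -/
def val (ν : LatticeValuation F d a) (x : Fˣ) : Fin d → ℤ := Multiplicative.toAdd (ν.hom x)

/-- The set `F_{≥ u}`: zero, and all nonzero elements of value at least `u`. -/
def geSet (ν : LatticeValuation F d a) (u : Fin d → ℤ) : Set F :=
  {x | ∀ y : Fˣ, (y : F) = x → a ⬝ᵥ toReal u ≤ a ⬝ᵥ toReal (ν.val y)}

lemma val_mul (ν : LatticeValuation F d a) (x y : Fˣ) :
    a ⬝ᵥ toReal (ν.val (x * y)) = a ⬝ᵥ toReal (ν.val x) + a ⬝ᵥ toReal (ν.val y) := by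
  rw [← dotProduct_add]
  congr 1
  funext i
  simp [toReal, val]

lemma val_one (ν : LatticeValuation F d a) : a ⬝ᵥ toReal (ν.val 1) = 0 := by
  have h := ν.val_mul 1 1
  rw [mul_one] at h
  linarith

lemma val_neg_one (ν : LatticeValuation F d a) : a ⬝ᵥ toReal (ν.val (-1)) = 0 := by
  have h := ν.val_mul (-1) (-1)
  rw [neg_mul_neg, mul_one, ν.val_one] at h
  linarith

lemma val_inv (ν : LatticeValuation F d a) (x : Fˣ) :
    a ⬝ᵥ toReal (ν.val x⁻¹) = - (a ⬝ᵥ toReal (ν.val x)) := by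
  have h := ν.val_mul x x⁻¹
  rw [mul_inv_cancel, ν.val_one] at h
  linarith

lemma dot_zero : a ⬝ᵥ toReal (0 : Fin d → ℤ) = 0 := by
  simp [toReal, dotProduct]

/-- The valuation ring `V = F_{≥ 0}` of `ν`. -/
def valuationRing (ν : LatticeValuation F d a) : ValuationSubring F where
  carrier := ν.geSet 0
  zero_mem' := fun y hy => absurd hy y.ne_zero
  one_mem' := by
    intro y hy
    have : y = 1 := Units.ext hy
    rw [this, ν.val_one, dot_zero]
  mul_mem' := by
    intro x y hx hy z hz
    have hxy : x * y ≠ 0 := hz ▸ z.ne_zero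
    have hx0 : x ≠ 0 := left_ne_zero_of_mul hxy
    have hy0 : y ≠ 0 := right_ne_zero_of_mul hxy
    have : z = Units.mk0 x hx0 * Units.mk0 y hy0 := Units.ext (by simpa using hz)
    rw [this, ν.val_mul, dot_zero]
    have h1 := hx (Units.mk0 x hx0) rfl
    have h2 := hy (Units.mk0 y hy0) rfl
    rw [dot_zero] at h1 h2
    linarith
  add_mem' := by
    intro x y hx hy z hz
    by_cases hx0 : x = 0
    · exact hy z (by rw [hz, hx0, zero_add])
    by_cases hy0 : y = 0
    · exact hx z (by rw [hz, hy0, add_zero])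
    exact le_trans (le_min (hx (Units.mk0 x hx0) rfl) (hy (Units.mk0 y hy0) rfl))
      (ν.min_le_add (Units.mk0 x hx0) (Units.mk0 y hy0) z hz)
  neg_mem' := by
    intro x hx z hz
    have hx0 : -z = -1 * z := by simp
    have h1 := hx (-z) (by simp [hz])
    rw [hx0, ν.val_mul, ν.val_neg_one, zero_add] at h1
    exact h1
  mem_or_inv_mem' := by
    intro x
    by_cases hx0 : x = 0
    · left
      intro y hy
      exact absurd (hy.trans hx0) y.ne_zero
    rcases le_total 0 (a ⬝ᵥ toReal (ν.val (Units.mk0 x hx0))) with h | h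
    · left
      intro y hy
      have : y = Units.mk0 x hx0 := Units.ext hy
      rw [this, dot_zero]
      exact h
    · right
      intro y hy
      have : y = (Units.mk0 x hx0)⁻¹ := Units.ext (by simpa using hy)
      rw [this, dot_zero, ν.val_inv]
      linarith

/-- The closed cone in `ℝ^d` generated by the semigroup `ν(D) = ν(D ∖ 0)`: the closure of the set
of all linear combinations of elements of `ν(D)` with nonnegative coefficients. -/
def closedCone (ν : LatticeValuation F d a) (D : Type*) [CommRing D] [Algebra D F] :
    Set (Fin d → ℝ) :=
  closure (Submodule.span ℝ≥0
    {u : Fin d → ℝ | ∃ (x : D) (y : Fˣ), (y : F) = algebraMap D F x ∧ u = toReal (ν.val y)} :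
      Set (Fin d → ℝ))

/-- The valuation `ν` is OK relative to the local domain `D` with fraction field `F`. -/
structure IsOKRelativeTo (ν : LatticeValuation F d a) (D : Type*) [CommRing D] [IsDomain D]
    [IsLocalRing D] [Algebra D F] : Prop where
  /-- `D` is a subring of the valuation ring `V`. -/
  mem_valuationRing : ∀ x : D, algebraMap D F x ∈ ν.valuationRing
  /-- `D` is dominated by `V`: the inclusion `D → V` is a local homomorphism. -/
  isLocalHom : IsLocalHom
    ((algebraMap D F).codRestrict ν.valuationRing.toSubring mem_valuationRing)
  /-- The domination is strong: the closed cone generated by `ν(D)` is pointed by `a`. -/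
  pointed : ∀ u ∈ ν.closedCone D, u ≠ 0 → 0 < a ⬝ᵥ u
  /-- The extension of residue fields is finite. -/
  finite_residueField : (IsLocalRing.ResidueField.map (S := ν.valuationRing)
    ((algebraMap D F).codRestrict ν.valuationRing.toSubring mem_valuationRing)).Finite
  /-- `D ∩ F_{≥ n v} ⊆ 𝔪 ^ n` for some `v` and all `n`. -/
  exists_vector : ∃ v : Fin d → ℤ, ∀ (n : ℕ) (x : D),
    algebraMap D F x ∈ ν.geSet (n • v) → x ∈ IsLocalRing.maximalIdeal D ^ n

end LatticeValuation

/-- A ring `D` is an OK domain if it is a (Noetherian) local domain, of dimension `d` say, and if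
its fraction field carries a valuation with value group `ℤ^d`, with respect to some embedding
`u ↦ ⟨a, u⟩` of `ℤ^d` into `ℝ`, that is OK relative to `D`. -/
def IsOKDomain (D : Type*) [CommRing D] : Prop :=
  ∃ (_ : IsDomain D) (_ : IsLocalRing D) (_ : IsNoetherianRing D) (d : ℕ) (a : Fin d → ℝ)
    (ν : LatticeValuation (FractionRing D) d a),
    ringKrullDim D = d ∧ LinearIndependent ℚ a ∧ ν.IsOKRelativeTo D

/-- The Frobenius power `J^{[p]}`, generated by the `p`-th powers of the elements of `J`. -/
def frobeniusPower {R : Type*} [CommRing R] (p : ℕ) (J : Ideal R) : Ideal R :=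
  Ideal.span ((fun x => x ^ p) '' (J : Set R))

/-- A `p`-family of ideals; `I e` is the member with index `q = p ^ e`. -/
def IsPFamily {R : Type*} [CommRing R] (p : ℕ) (I : ℕ → Ideal R) : Prop :=
  ∀ e : ℕ, frobeniusPower p (I e) ≤ I (e + 1)

/-- `J` is primary to the maximal ideal of the local ring `R`. -/
def IsMaximalPrimary {R : Type*} [CommRing R] [IsLocalRing R] (J : Ideal R) : Prop :=
  J.IsPrimary ∧ J.radical = IsLocalRing.maximalIdeal R

/-- The Krull dimension as a natural number (for nonzero rings of finite dimension). -/
def natDim (R : Type*) [CommRing R] : ℕ := ((ringKrullDim R).unbotD 0).toNat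

/-- The quotient `ℓ_R(R / I_q) / q ^ d`, where `q = p ^ e` and `d = dim R`; the length is finite
for the ideals primary to the maximal ideal of a Noetherian local ring. -/
def normalizedLength (p : ℕ) (R : Type*) [CommRing R] (I : ℕ → Ideal R) (e : ℕ) : ℝ :=
  ((Module.length R (R ⧸ I e)).toNat : ℝ) / ((p : ℝ) ^ e) ^ natDim R

/-- The volume of `I`: the limit of the normalized lengths (arbitrary if there is no limit). -/
def volume (p : ℕ) (R : Type*) [CommRing R] (I : ℕ → Ideal R) : ℝ :=
  Filter.limUnder Filter.atTop (normalizedLength p R I)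

/-- The limit that defines the volume of `I` exists (and is finite). -/
def VolumeExists (p : ℕ) (R : Type*) [CommRing R] (I : ℕ → Ideal R) : Prop :=
  Filter.Tendsto (normalizedLength p R I) Filter.atTop (𝓝 (volume p R I))

/-- The extension `I A` of the sequence `I` to `A = R / P`, term by term. -/
def extend {R : Type*} [CommRing R] (I : ℕ → Ideal R) (P : Ideal R) : ℕ → Ideal (R ⧸ P) :=
  fun e => (I e).map (Ideal.Quotient.mk P)

open Classical in
/-- The minimal primes `P` of the Noetherian ring `R` with `dim R / P = dim R`. -/
def topMinimalPrimes (R : Type*) [CommRing R] [IsNoetherianRing R] : Finset (Ideal R) :=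
  (minimalPrimes.finite_of_isNoetherianRing R).toFinset.filter
    fun P => ringKrullDim (R ⧸ P) = ringKrullDim R

end OKVol

end

/-! Domain case. Filter an OK domain `D` by the ideals `level` of elements of weight at least `n`,
the weight being `⟨a, ν(x)⟩`. Since `a` has rationally independent coordinates, distinct values have
distinct weights, so the filtration crosses one value at a time. For an ideal `I`, the length of `I
/ (I ∩ level n)` is a sum over the values of `I` below `n`. Each contributes at most the length `κ`
of the residue field of `V`, and exactly `κ` when every residue class is attained by elements of `I`
(`Fills`).

If `I_q` has a value `u`, then `x ^ p ∈ I_{pq}` has value `p u`. Multiplying by suitable fixed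
elements of `D` turns this into `p ^ d` filled values `p u + r + const`, with `r ∈ [0, p) ^ d`. So
the length of `I_q / (I_q ∩ level (B q - c))` gains at least a factor `p ^ d` when `q` becomes `p
q`. Divided by `q ^ d` it is increasing, and it is bounded because level ideals have colength `O(q ^
d)`; hence it converges (`exists_tendsto_truncation`). For large `B` the truncating level lies
inside `I_q`, by the last OK condition. Subtracting the limit for `I_q` from the limit for the unit
family gives the limit for `D / I_q`.

Reduced case. With minimal primes `P_i`, choose `c_i ∉ P_i` lying in all other `P_j`. Then `c_i`
kills `P_i`, and `c = ∑ c_i` is a nonzerodivisor. The length of `R / J` and the sum of the lengths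
of `R / (P_i + J)` differ by at most a constant times the length of `R / (c, J)`
(`exists_abs_length_sub_sum_le`). For `J = I_q` this error is `o(q ^ d)`, as `R / c` has smaller
dimension; components of smaller dimension vanish in the limit likewise. -/

section LengthBounds

/-! ### Lengths of quotients, and ideals of powers of generators. -/

variable {R : Type*} [CommRing R]

/-- If `ker g ≤ range f` in `N → M → Q`, the length of the middle term is bounded by the sum of the
lengths of the outer terms. -/
lemma Module.length_le_add_of_ker_le_range {M N Q : Type*} [AddCommGroup M] [AddCommGroup N]
    [AddCommGroup Q] [Module R M] [Module R N] [Module R Q] (f : N →ₗ[R] M) (g : M →ₗ[R] Q)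
    (h : LinearMap.ker g ≤ LinearMap.range f) :
    Module.length R M ≤ Module.length R N + Module.length R Q := by
  rw [Module.length_eq_add_of_exact (LinearMap.ker g).subtype g.rangeRestrict
    (Submodule.subtype_injective _) g.surjective_rangeRestrict
    (by intro x; simp [LinearMap.rangeRestrict, LinearMap.codRestrict_apply, Subtype.ext_iff])]
  refine add_le_add ?_ (Module.length_le_of_injective _ (Submodule.subtype_injective _))
  exact (Module.length_le_of_injective _ (Submodule.inclusion_injective h)).trans
    (Module.length_le_of_surjective f.rangeRestrict f.surjective_rangeRestrict)

lemma Module.length_quotient_anti {M : Type*} [AddCommGroup M] [Module R M] {A B : Submodule R M}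
    (h : A ≤ B) : Module.length R (M ⧸ B) ≤ Module.length R (M ⧸ A) :=
  Module.length_le_of_surjective (Submodule.factor h) (Submodule.factor_surjective h)

/-- The map `f` has kernel `A`, so it identifies `B / A` with its range. -/
lemma Module.length_quotient_eq_add_range {M Q : Type*} [AddCommGroup M] [AddCommGroup Q]
    [Module R M] [Module R Q] {A B : Submodule R M} (h : A ≤ B) (f : B →ₗ[R] Q)
    (hf : ∀ x : B, f x = 0 ↔ (x : M) ∈ A) :
    Module.length R (M ⧸ A) =
      Module.length R (LinearMap.range f) + Module.length R (M ⧸ B) := by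
  set g : B →ₗ[R] M ⧸ A := A.mkQ ∘ₗ B.subtype with hg
  have hker : LinearMap.ker f = LinearMap.ker g := by
    ext x
    simp [hg, hf]
  have e : Module.length R (LinearMap.range f) = Module.length R (LinearMap.range g) := by
    rw [← f.quotKerEquivRange.length_eq, ← g.quotKerEquivRange.length_eq, hker]
  rw [e]
  refine Module.length_eq_add_of_exact (LinearMap.range g).subtype (Submodule.factor h)
    (Submodule.subtype_injective _) (Submodule.factor_surjective h) ?_
  intro x
  obtain ⟨x, rfl⟩ := Submodule.Quotient.mk_surjective _ x
  constructor
  · intro hx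
    have hx' : x ∈ B := by simpa using hx
    exact ⟨⟨_, ⟨x, hx'⟩, rfl⟩, rfl⟩
  · rintro ⟨⟨_, y, rfl⟩, hy⟩
    rw [← hy]
    simp [hg]

lemma Module.length_quotient_le_add {M Q : Type*} [AddCommGroup M] [AddCommGroup Q]
    [Module R M] [Module R Q] {A B : Submodule R M} (h : A ≤ B) (f : B →ₗ[R] Q)
    (hf : ∀ x : B, f x = 0 ↔ (x : M) ∈ A) :
    Module.length R (M ⧸ A) ≤ Module.length R (M ⧸ B) + Module.length R Q := by
  rw [Module.length_quotient_eq_add_range h f hf, add_comm]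
  gcongr
  exact Module.length_le_of_injective _ (Submodule.subtype_injective _)

lemma Module.length_quotient_eq_add {M Q : Type*} [AddCommGroup M] [AddCommGroup Q]
    [Module R M] [Module R Q] {A B : Submodule R M} (h : A ≤ B) (f : B →ₗ[R] Q)
    (hf : ∀ x : B, f x = 0 ↔ (x : M) ∈ A) (hs : Function.Surjective f) :
    Module.length R (M ⧸ A) = Module.length R (M ⧸ B) + Module.length R Q := by
  rw [Module.length_quotient_eq_add_range h f hf, add_comm, LinearMap.range_eq_top.mpr hs,
    Module.length_top]

namespace Ideal

/-- Multiplication by `x` maps `R / (J, y)` to `R / (J, x y)` with cokernel `R / (J, x)`. -/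
lemma length_quotient_sup_span_mul_le (J : Ideal R) (x y : R) :
    Module.length R (R ⧸ J ⊔ span {x * y}) ≤
      Module.length R (R ⧸ J ⊔ span {x}) + Module.length R (R ⧸ J ⊔ span {y}) := by
  have h1 : J ⊔ span {y} ≤ Submodule.comap (LinearMap.mulLeft R x) (J ⊔ span {x * y}) := by
    refine sup_le (fun z hz => ?_) ?_
    · exact mem_sup_left (J.mul_mem_left x hz)
    · rw [span_singleton_le_iff_mem]
      exact mem_sup_right (mem_span_singleton_self _)
  have h2 : J ⊔ span {x * y} ≤ J ⊔ span {x} :=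
    sup_le_sup le_rfl ((span_singleton_le_iff_mem _).mpr
      (mem_span_singleton'.mpr ⟨y, mul_comm _ _⟩))
  rw [add_comm]
  refine Module.length_le_add_of_ker_le_range
    (Submodule.mapQ (J ⊔ span {y}) (J ⊔ span {x * y}) _ h1) (Submodule.factor h2) ?_
  intro z hz
  obtain ⟨z, rfl⟩ := Submodule.Quotient.mk_surjective _ z
  have hz' : z ∈ J ⊔ span {x} := Ideal.Quotient.eq_zero_iff_mem.mp (by simpa using hz)
  obtain ⟨j, hj, w, hw, rfl⟩ := Submodule.mem_sup.mp hz'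
  obtain ⟨r, rfl⟩ := mem_span_singleton'.mp hw
  refine ⟨Submodule.Quotient.mk r, ?_⟩
  rw [Submodule.mapQ_apply, Submodule.Quotient.eq]
  refine mem_sup_left ?_
  have : (LinearMap.mulLeft R x) r - (j + r * x) = -j := by
    simp only [LinearMap.mulLeft_apply]; ring
  rw [this]
  exact J.neg_mem hj

lemma length_quotient_sup_span_pow_le (J : Ideal R) (x : R) (n : ℕ) :
    Module.length R (R ⧸ J ⊔ span {x ^ n}) ≤ n * Module.length R (R ⧸ J ⊔ span {x}) := by
  induction n with
  | zero =>
    have : Subsingleton (R ⧸ J ⊔ span {x ^ 0}) := by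
      rw [Ideal.Quotient.subsingleton_iff, pow_zero, span_singleton_one, sup_top_eq]
    simp
  | succ n ih =>
    rw [pow_succ]
    refine (length_quotient_sup_span_mul_le J _ _).trans ?_
    push_cast
    rw [add_mul, one_mul]
    gcongr

/-- The generators are raised to the power `n` one at a time, each costing a factor `n`; `J` varies
in the induction to absorb the generators set aside. -/
lemma length_quotient_sup_span_image_pow_le [DecidableEq R] (s : Finset R) (n : ℕ) (J : Ideal R) :
    Module.length R (R ⧸ J ⊔ span ((fun x => x ^ n) '' (s : Set R))) ≤
      (n : ℕ∞) ^ s.card * Module.length R (R ⧸ J ⊔ span (s : Set R)) := by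
  induction s using Finset.induction_on generalizing J with
  | empty =>
    rw [Finset.coe_empty, Set.image_empty, Finset.card_empty, pow_zero, one_mul]
  | insert a s ha ih =>
    have e1 : J ⊔ span ((fun x => x ^ n) '' ((insert a s : Finset R) : Set R)) =
        (J ⊔ span ((fun x => x ^ n) '' (s : Set R))) ⊔ span {a ^ n} := by
      rw [Finset.coe_insert, Set.image_insert_eq, span_insert, sup_comm (span {a ^ n}), sup_assoc]
    have e2 : (J ⊔ span ((fun x => x ^ n) '' (s : Set R))) ⊔ span {a} =
        (J ⊔ span {a}) ⊔ span ((fun x => x ^ n) '' (s : Set R)) := sup_right_comm _ _ _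
    have e3 : J ⊔ span ((insert a s : Finset R) : Set R) = (J ⊔ span {a}) ⊔ span (s : Set R) := by
      rw [Finset.coe_insert, span_insert, sup_assoc]
    rw [e1, e3, Finset.card_insert_of_notMem ha, pow_succ', mul_assoc]
    refine (length_quotient_sup_span_pow_le _ _ _).trans ?_
    rw [e2]
    gcongr
    exact ih _

lemma span_finset_pow_le (s : Finset R) (n : ℕ) :
    span (s : Set R) ^ (s.card * n + 1) ≤ span ((fun x => x ^ n) '' (s : Set R)) := by
  classical
  induction s using Finset.induction_on with
  | empty => simp
  | insert a s ha ih =>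
    rw [Finset.coe_insert, Set.image_insert_eq, span_insert, span_insert,
      Finset.card_insert_of_notMem ha,
      show (s.card + 1) * n + 1 = n + (s.card * n + 1) by ring]
    refine sup_pow_add_le_pow_sup_pow.trans (sup_le_sup ?_ ih)
    rw [span_singleton_pow]

end Ideal

end LengthBounds

/-! ### Polynomial growth of lengths in Noetherian local rings. -/

section ParameterBounds

open IsLocalRing

variable {R : Type*} [CommRing R] [IsLocalRing R]

lemma IsLocalRing.maximalIdeal_quotient_le_map (J : Ideal R) [IsLocalRing (R ⧸ J)] :
    maximalIdeal (R ⧸ J) ≤ (maximalIdeal R).map (Ideal.Quotient.mk J) := by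
  intro x hx
  obtain ⟨y, rfl⟩ := Ideal.Quotient.mk_surjective x
  refine Ideal.mem_map_of_mem _ ?_
  rw [mem_maximalIdeal, mem_nonunits_iff] at hx ⊢
  exact fun hy => hx (hy.map _)

variable [IsNoetherianRing R]

lemma IsLocalRing.length_quotient_ne_top_of_pow_le {J : Ideal R} {n : ℕ}
    (h : maximalIdeal R ^ n ≤ J) : Module.length R (R ⧸ J) ≠ ⊤ := by
  have : IsArtinianRing (R ⧸ J) := by
    rcases subsingleton_or_nontrivial (R ⧸ J) with hs | hs
    · infer_instance
    have : IsLocalRing (R ⧸ J) := .of_surjective' _ Ideal.Quotient.mk_surjective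
    rw [isArtinianRing_iff_isNilpotent_maximalIdeal]
    refine ⟨n, le_bot_iff.mp ((Ideal.pow_right_mono (maximalIdeal_quotient_le_map J) n).trans ?_)⟩
    rw [← Ideal.map_pow, le_bot_iff, Ideal.map_eq_bot_iff_le_ker, Ideal.mk_ker]
    exact h
  rw [Module.length_eq_of_surjective (R := R ⧸ J) (S := R) Ideal.Quotient.mk_surjective]
  exact Module.length_ne_top

/-- A Noetherian local ring of dimension `d` has an ideal with `d` generators that contains a power
of the maximal ideal. -/
lemma IsLocalRing.exists_finset_pow_maximalIdeal_le :
    ∃ (s : Finset R) (n : ℕ), (s.card : WithBot ℕ∞) = ringKrullDim R ∧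
      Ideal.span (s : Set R) ≤ maximalIdeal R ∧ maximalIdeal R ^ n ≤ Ideal.span (s : Set R) := by
  obtain ⟨s, hs, hcard⟩ :=
    (maximalIdeal R).exists_finset_card_eq_height_of_isNoetherianRing
  have hrad : maximalIdeal R ≤ (Ideal.span (s : Set R)).radical := by
    rw [Ideal.radical_eq_sInf]
    refine le_sInf fun P hP => ?_
    have := hP.2
    exact hs.2 ⟨hP.2, hP.1⟩ (le_maximalIdeal hP.2.ne_top)
  obtain ⟨n, hn⟩ := Ideal.exists_pow_le_of_le_radical_of_fg hrad (IsNoetherian.noetherian _)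
  refine ⟨s, n, ?_, hs.1.2, hn⟩
  rw [← maximalIdeal_height_eq_ringKrullDim, ← hcard]
  rfl

/-- If `J n` contains the `n`-th powers of the elements of an ideal containing a power of the
maximal ideal, the length of `R / J n` grows at most like `n ^ dim R`. -/
lemma IsLocalRing.exists_length_quotient_le {I₀ : Ideal R} {N : ℕ} (hN : maximalIdeal R ^ N ≤ I₀)
    {d : ℕ} (hd : ringKrullDim R = d) :
    ∃ C : ℕ, ∀ (n : ℕ) (J : Ideal R), (∀ x ∈ I₀, x ^ n ∈ J) →
      Module.length R (R ⧸ J) ≤ C * (n : ℕ∞) ^ d := by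
  classical
  obtain ⟨s, k, hcard, hs, hk⟩ := IsLocalRing.exists_finset_pow_maximalIdeal_le (R := R)
  have hsd : s.card = d := by
    rw [hd] at hcard
    exact_mod_cast hcard
  have hfin : Module.length R (R ⧸ Ideal.span (s : Set R)) ≠ ⊤ :=
    length_quotient_ne_top_of_pow_le hk
  -- Each parameter `x` has `x ^ N ∈ I₀`, hence `x ^ (N * n) ∈ J`; raising `d` parameters to the
  -- power `N * n` multiplies the length by at most `(N * n) ^ d`.
  refine ⟨N ^ d * (Module.length R (R ⧸ Ideal.span (s : Set R))).toNat, fun n J hJ => ?_⟩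
  have hle : Ideal.span ((fun x => x ^ (N * n)) '' (s : Set R)) ≤ J := by
    rw [Ideal.span_le]
    rintro _ ⟨x, hx, rfl⟩
    show x ^ (N * n) ∈ J
    rw [pow_mul]
    exact hJ _ (hN (Ideal.pow_mem_pow (hs (Ideal.subset_span hx)) N))
  have h := Ideal.length_quotient_sup_span_image_pow_le s (N * n) ⊥
  rw [bot_sup_eq, bot_sup_eq, hsd] at h
  refine (Module.length_quotient_anti hle).trans (h.trans ?_)
  push_cast
  rw [ENat.natCast_toNat hfin, mul_pow]
  apply le_of_eq
  ring

end ParameterBounds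

/-! ### The filtration of a domain by weight and its graded pieces. -/

namespace OKVol

/-- The linear form `u ↦ ⟨a, u⟩` on `ℤ^d`. -/
noncomputable def weight {d : ℕ} (a : Fin d → ℝ) : (Fin d → ℤ) →+ ℝ where
  toFun u := a ⬝ᵥ toReal u
  map_zero' := LatticeValuation.dot_zero
  map_add' u v := by
    rw [← dotProduct_add]
    congr 1
    funext i
    simp [toReal]

lemma weight_injective {d : ℕ} {a : Fin d → ℝ} (ha : LinearIndependent ℚ a) :
    Function.Injective (weight a) := by
  rw [injective_iff_map_eq_zero]
  intro u hu
  have h := Fintype.linearIndependent_iff.mp ha (fun i => (u i : ℚ)) (by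
    have : ∑ i, a i * (u i : ℝ) = 0 := hu
    rw [← this]
    refine Finset.sum_congr rfl fun i _ => ?_
    rw [Rat.smul_def, mul_comm]
    simp)
  funext i
  exact_mod_cast h i

namespace LatticeValuation

variable {F : Type*} [Field F] {d : ℕ} {a : Fin d → ℝ} (ν : LatticeValuation F d a)

lemma val_mul_eq_add (x y : Fˣ) : ν.val (x * y) = ν.val x + ν.val y := by
  simp [val]

lemma val_pow_eq_nsmul (x : Fˣ) (n : ℕ) : ν.val (x ^ n) = n • ν.val x := by
  simp [val]

lemma exists_val_eq (u : Fin d → ℤ) : ∃ y : Fˣ, ν.val y = u := by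
  obtain ⟨y, hy⟩ := ν.surjective_hom (Multiplicative.ofAdd u)
  exact ⟨y, by rw [val, hy, toAdd_ofAdd]⟩

lemma weight_val_mul (x y : Fˣ) :
    weight a (ν.val (x * y)) = weight a (ν.val x) + weight a (ν.val y) := by
  rw [val_mul_eq_add, map_add]

lemma weight_val_inv (x : Fˣ) : weight a (ν.val x⁻¹) = -weight a (ν.val x) := ν.val_inv x

lemma mem_valuationRing_iff {x : F} :
    x ∈ ν.valuationRing ↔ ∀ y : Fˣ, (y : F) = x → 0 ≤ weight a (ν.val y) := by
  rw [← map_zero (weight a)]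
  rfl

lemma residue_eq_zero_iff (v : ν.valuationRing) :
    IsLocalRing.residue ν.valuationRing v = 0 ↔
      ∀ y : Fˣ, (y : F) = v → 0 < weight a (ν.val y) := by
  rw [IsLocalRing.residue_eq_zero_iff, IsLocalRing.mem_maximalIdeal, mem_nonunits_iff]
  constructor
  · intro h y hy
    by_contra! hle
    refine h (IsUnit.of_mul_eq_one ⟨((y⁻¹ : Fˣ) : F), ?_⟩ (Subtype.ext ?_))
    · rw [mem_valuationRing_iff]
      intro z hz
      rw [Units.ext hz, weight_val_inv]
      linarith
    · show (v : F) * ((y⁻¹ : Fˣ) : F) = 1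
      rw [← hy]
      simp
  · rintro h ⟨w, rfl⟩
    have e : (w : ν.valuationRing) * ((w⁻¹ : (ν.valuationRing)ˣ) : ν.valuationRing) = 1 := by simp
    set y : Fˣ := Units.map (algebraMap ν.valuationRing F).toMonoidHom w with hy
    have h1 := h y rfl
    have h2 := (ν.mem_valuationRing_iff).mp
      ((w⁻¹ : (ν.valuationRing)ˣ) : ν.valuationRing).2 y⁻¹ rfl
    rw [weight_val_inv] at h2
    linarith

section Levels

variable {D : Type*} [CommRing D] [Algebra D F] [Algebra D ν.valuationRing]
  [IsScalarTower D ν.valuationRing F]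

lemma algebraMap_mem_valuationRing (x : D) : algebraMap D F x ∈ ν.valuationRing := by
  rw [IsScalarTower.algebraMap_apply D ν.valuationRing F]
  exact (algebraMap D ν.valuationRing x).2

variable (D) in
/-- The ideal of elements of `D` with zero value or value in an upper set. -/
def level (U : UpperSet ℝ) : Ideal D where
  carrier := {x | ∀ y : Fˣ, (y : F) = algebraMap D F x → weight a (ν.val y) ∈ U}
  zero_mem' y hy := absurd (hy.trans (map_zero _)) y.ne_zero
  add_mem' := by
    intro x y hx hy z hz
    rw [map_add] at hz
    by_cases hx0 : algebraMap D F x = 0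
    · exact hy z (by rw [hz, hx0, zero_add])
    by_cases hy0 : algebraMap D F y = 0
    · exact hx z (by rw [hz, hy0, add_zero])
    have h := ν.min_le_add (Units.mk0 _ hx0) (Units.mk0 _ hy0) z hz
    rcases min_le_iff.mp h with h | h
    · exact U.upper h (hx (Units.mk0 _ hx0) rfl)
    · exact U.upper h (hy (Units.mk0 _ hy0) rfl)
  smul_mem' := by
    intro c x hx z hz
    rw [smul_eq_mul, map_mul] at hz
    have hcx : algebraMap D F c * algebraMap D F x ≠ 0 := hz ▸ z.ne_zero
    have hc0 := left_ne_zero_of_mul hcx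
    have hx0 := right_ne_zero_of_mul hcx
    have e : z = Units.mk0 _ hc0 * Units.mk0 _ hx0 := Units.ext (by simpa using hz)
    have h1 := ν.mem_valuationRing_iff.mp (ν.algebraMap_mem_valuationRing c) (Units.mk0 _ hc0) rfl
    rw [e, weight_val_mul]
    exact U.upper (by linarith) (hx (Units.mk0 _ hx0) rfl)

lemma mem_level_Ici {n : ℝ} {x : D} :
    x ∈ ν.level D (UpperSet.Ici n) ↔
      ∀ y : Fˣ, (y : F) = algebraMap D F x → n ≤ weight a (ν.val y) := Iff.rfl

lemma mem_level_Ioi {n : ℝ} {x : D} :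
    x ∈ ν.level D (UpperSet.Ioi n) ↔
      ∀ y : Fˣ, (y : F) = algebraMap D F x → n < weight a (ν.val y) := Iff.rfl

/-- Division by `g` followed by reduction, from elements of value at least that of `g` to the
residue field of the valuation. -/
noncomputable def resMap (g : Fˣ) (J : Ideal D) (hJ : J ≤ ν.level D (UpperSet.Ici (weight a (ν.val g)))) :
    J →ₗ[D] IsLocalRing.ResidueField ν.valuationRing :=
  (IsScalarTower.toAlgHom D ν.valuationRing
    (IsLocalRing.ResidueField ν.valuationRing)).toLinearMap ∘ₗ
  { toFun := fun x => ⟨algebraMap D F x * ((g⁻¹ : Fˣ) : F), by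
      rw [mem_valuationRing_iff]
      intro y hy
      have h := ν.mem_level_Ici.mp (hJ x.2) (y * g) (by simp [hy])
      rw [weight_val_mul] at h
      linarith⟩
    map_add' := fun x y => Subtype.ext (by
      show algebraMap D F (x + y) * _ = algebraMap D F x * _ + algebraMap D F y * _
      rw [map_add, add_mul])
    map_smul' := fun c x => Subtype.ext (by
      show algebraMap D F (c * x) * _ = ((c • (_ : ν.valuationRing) : ν.valuationRing) : F)
      rw [Algebra.smul_def, map_mul, mul_assoc, IsScalarTower.algebraMap_apply D ν.valuationRing F]
      rfl) }

lemma resMap_apply {g : Fˣ} {J : Ideal D} (hJ : J ≤ ν.level D (UpperSet.Ici (weight a (ν.val g))))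
    (x : J) (v : ν.valuationRing) (h : algebraMap D F x = v * g) :
    ν.resMap g J hJ x = IsLocalRing.residue _ v := by
  show IsLocalRing.residue _ _ = _
  congr 1
  exact Subtype.ext (by simp [h])

lemma resMap_eq_zero_iff {g : Fˣ} {J : Ideal D}
    (hJ : J ≤ ν.level D (UpperSet.Ici (weight a (ν.val g)))) (x : J) :
    ν.resMap g J hJ x = 0 ↔ (x : D) ∈ ν.level D (UpperSet.Ioi (weight a (ν.val g))) := by
  show IsLocalRing.residue ν.valuationRing _ = 0 ↔ _
  rw [residue_eq_zero_iff, mem_level_Ioi]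
  constructor
  · intro h y hy
    have := h (y * g⁻¹) (by simp [hy])
    rw [weight_val_mul, weight_val_inv] at this
    linarith
  · intro h y hy
    have := h (y * g) (by simp [hy])
    rw [weight_val_mul] at this
    linarith

lemma inf_level_Ioi_le (I : Ideal D) (t : ℝ) :
    I ⊓ ν.level D (UpperSet.Ioi t) ≤ I ⊓ ν.level D (UpperSet.Ici t) :=
  inf_le_inf le_rfl fun _ hx y hy => (ν.mem_level_Ioi.mp hx y hy).le

variable (D) in
/-- The length of the residue field of the valuation ring as a `D`-module. -/
noncomputable def resLength : ℕ∞ := Module.length D (IsLocalRing.ResidueField ν.valuationRing)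

/-- A graded piece of `I` embeds in the residue field of `V` by `x ↦ x / g`. -/
lemma length_quotient_level_Ioi_le (I : Ideal D) (g : Fˣ) :
    Module.length D (D ⧸ I ⊓ ν.level D (UpperSet.Ioi (weight a (ν.val g)))) ≤
      Module.length D (D ⧸ I ⊓ ν.level D (UpperSet.Ici (weight a (ν.val g)))) +
        ν.resLength D :=
  Module.length_quotient_le_add (ν.inf_level_Ioi_le I _) (ν.resMap g _ inf_le_right) fun x => by
    rw [resMap_eq_zero_iff, Submodule.mem_inf]
    exact ⟨fun h => ⟨x.2.1, h⟩, fun h => h.2⟩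

/-- Every residue class is the class of `x / g` for some `x` in `I`. -/
def Fills (I : Ideal D) (g : Fˣ) : Prop :=
  ∀ c : IsLocalRing.ResidueField ν.valuationRing, ∃ x ∈ I, ∃ v : ν.valuationRing,
    IsLocalRing.residue _ v = c ∧ algebraMap D F x = v * g

lemma length_quotient_level_Ioi_eq (I : Ideal D) (g : Fˣ) (hg : ν.Fills I g) :
    Module.length D (D ⧸ I ⊓ ν.level D (UpperSet.Ioi (weight a (ν.val g)))) =
      Module.length D (D ⧸ I ⊓ ν.level D (UpperSet.Ici (weight a (ν.val g)))) +
        ν.resLength D := by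
  refine Module.length_quotient_eq_add (ν.inf_level_Ioi_le I _) (ν.resMap g _ inf_le_right)
    (fun x => ?_) fun c => ?_
  · rw [resMap_eq_zero_iff, Submodule.mem_inf]
    exact ⟨fun h => ⟨x.2.1, h⟩, fun h => h.2⟩
  · obtain ⟨x, hx, v, rfl, hv⟩ := hg c
    refine ⟨⟨x, hx, ?_⟩, ν.resMap_apply _ _ v hv⟩
    intro y hy
    have := ν.mem_valuationRing_iff.mp v.2 (y * g⁻¹) (by simp [hy, hv])
    rw [weight_val_mul, weight_val_inv] at this
    show weight a (ν.val g) ≤ weight a (ν.val y)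
    linarith

/-- The values of the nonzero elements of an ideal. -/
def values (I : Ideal D) : Set (Fin d → ℤ) :=
  {u | ∃ x ∈ I, ∃ y : Fˣ, (y : F) = algebraMap D F x ∧ ν.val y = u}

/-- Upper count: each value of `I` below `n` contributes one graded piece, of length at most
`resLength`. The induction removes the heaviest element of `X`. -/
lemma length_quotient_inf_level_le (I : Ideal D) (X : Finset (Fin d → ℤ)) (n : ℝ)
    (h : ∀ u ∈ ν.values I, u ∈ X ∨ n ≤ weight a u) :
    Module.length D (D ⧸ I ⊓ ν.level D (UpperSet.Ici n)) ≤
      Module.length D (D ⧸ I) + X.card * ν.resLength D := by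
  classical
  induction X using Finset.induction_on_max_value (weight a) generalizing n with
  | empty =>
    have : I ≤ I ⊓ ν.level D (UpperSet.Ici n) := le_inf le_rfl fun x hx y hy => by
      simpa using h _ ⟨x, hx, y, hy, rfl⟩
    exact (Module.length_quotient_anti this).trans le_self_add
  | insert u X hu hmax ih =>
    have hcard : ((insert u X).card : ℕ∞) * ν.resLength D =
        X.card * ν.resLength D + ν.resLength D := by
      rw [Finset.card_insert_of_notMem hu]
      push_cast
      ring
    by_cases hn : n ≤ weight a u
    · refine (ih n fun w hw => ?_).trans ?_
      · rcases h w hw with h | h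
        · rcases Finset.mem_insert.mp h with rfl | h
          · exact Or.inr hn
          · exact Or.inl h
        · exact Or.inr h
      · rw [hcard, ← add_assoc]
        exact le_self_add
    · push Not at hn
      obtain ⟨g, rfl⟩ := ν.exists_val_eq u
      have h1 := ih (weight a (ν.val g)) fun w hw => by
        rcases h w hw with h | h
        · rcases Finset.mem_insert.mp h with rfl | h
          · exact Or.inr le_rfl
          · exact Or.inl h
        · exact Or.inr (hn.le.trans h)
      -- As `g` realises the maximal weight in `X`, any value of `I` strictly heavier is already at
      -- least `n`.
      have h2 : I ⊓ ν.level D (UpperSet.Ioi (weight a (ν.val g))) ≤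
          I ⊓ ν.level D (UpperSet.Ici n) := by
        rintro x ⟨hx, hxg⟩
        refine ⟨hx, fun y hy => ?_⟩
        have hlt := ν.mem_level_Ioi.mp hxg y hy
        rcases h _ ⟨x, hx, y, hy, rfl⟩ with h | h
        · rcases Finset.mem_insert.mp h with h | h
          · rw [h] at hlt
            exact absurd hlt (lt_irrefl _)
          · exact absurd (hmax _ h) (not_le.mpr hlt)
        · exact h
      refine (Module.length_quotient_anti h2).trans
        ((ν.length_quotient_level_Ioi_le I g).trans ?_)
      rw [hcard, ← add_assoc]
      gcongr

/-- Lower count: each filled value below `n` contributes a full copy of the residue field.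
Injectivity of `weight` excludes ties, so different elements of `X` give different graded pieces. -/
lemma le_length_quotient_inf_level (ha : LinearIndependent ℚ a) (I : Ideal D)
    (X : Finset (Fin d → ℤ)) (n : ℝ)
    (h : ∀ u ∈ X, weight a u < n ∧ ∃ g : Fˣ, ν.val g = u ∧ ν.Fills I g) :
    Module.length D (D ⧸ I) + X.card * ν.resLength D ≤
      Module.length D (D ⧸ I ⊓ ν.level D (UpperSet.Ici n)) := by
  classical
  induction X using Finset.induction_on_max_value (weight a) generalizing n with
  | empty => simpa using Module.length_quotient_anti inf_le_left
  | insert u X hu hmax ih =>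
    obtain ⟨hn, g, rfl, hg⟩ := h u (Finset.mem_insert_self _ _)
    have h1 := ih (weight a (ν.val g)) fun w hw =>
      ⟨lt_of_le_of_ne (hmax w hw) fun e => hu (weight_injective ha e ▸ hw),
        (h w (Finset.mem_insert_of_mem hw)).2⟩
    have hcard : ((insert (ν.val g) X).card : ℕ∞) * ν.resLength D =
        X.card * ν.resLength D + ν.resLength D := by
      rw [Finset.card_insert_of_notMem hu]
      push_cast
      ring
    rw [hcard, ← add_assoc]
    refine (add_le_add_left h1 _).trans ?_
    rw [← ν.length_quotient_level_Ioi_eq I g hg]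
    exact Module.length_quotient_anti
      (inf_le_inf le_rfl fun x hx y hy => hn.trans_le (ν.mem_level_Ici.mp hx y hy))

end Levels

end LatticeValuation

end OKVol

/-! ### Filled values and their multiplication under `p`-th powers. -/

namespace OKVol
namespace LatticeValuation

lemma mul_add_fin_injective {d p : ℕ} :
    Function.Injective fun x : (Fin d → ℤ) × (Fin d → Fin p) =>
      p • x.1 + fun i => ((x.2 i : ℕ) : ℤ) := by
  rintro ⟨u, r⟩ ⟨u', r'⟩ h
  have key : ∀ i, u i = u' i ∧ r i = r' i := by
    intro i
    have hi := congrFun h i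
    simp only [Pi.add_apply, nsmul_eq_mul] at hi
    change (p : ℤ) * u i + ((r i : ℕ) : ℤ) = (p : ℤ) * u' i + ((r' i : ℕ) : ℤ) at hi
    have h1 := (r i).2
    have h2 := (r' i).2
    have hp : (0 : ℤ) < p := by exact_mod_cast (Nat.zero_le _).trans_lt h1
    have hu : u i = u' i := by
      have e1 : ((p : ℤ) * u i + (r i : ℕ)) / p = u i := by
        rw [Int.mul_add_ediv_left _ _ hp.ne', Int.ediv_eq_zero_of_lt (by positivity)
          (by exact_mod_cast h1), add_zero]
      have e2 : ((p : ℤ) * u' i + (r' i : ℕ)) / p = u' i := by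
        rw [Int.mul_add_ediv_left _ _ hp.ne', Int.ediv_eq_zero_of_lt (by positivity)
          (by exact_mod_cast h2), add_zero]
      rw [← e1, ← e2, hi]
    refine ⟨hu, Fin.ext ?_⟩
    rw [hu] at hi
    exact_mod_cast add_left_cancel hi
  exact Prod.ext (funext fun i => (key i).1) (funext fun i => (key i).2)

lemma one_le_resLength {F : Type*} [Field F] {d : ℕ} {a : Fin d → ℝ} (ν : LatticeValuation F d a)
    (D : Type*) [CommRing D] [Algebra D ν.valuationRing] : 1 ≤ ν.resLength D := by
  exact Order.one_le_iff_pos.mpr Module.length_pos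

variable {F : Type*} [Field F] {d : ℕ} {a : Fin d → ℝ} (ν : LatticeValuation F d a)
  {D : Type*} [CommRing D] [Algebra D F]

/-- One `z` filled by the whole ring makes every value of every ideal filled after a fixed shift by
`ν.val z`. -/
lemma fills_mul {I : Ideal D} {x : D} (hx : x ∈ I) {y z : Fˣ} (hy : (y : F) = algebraMap D F x)
    (hz : ν.Fills (⊤ : Ideal D) z) : ν.Fills I (y * z) := by
  intro c
  obtain ⟨b, -, v, hv, hb⟩ := hz c
  refine ⟨x * b, I.mul_mem_right _ hx, v, hv, ?_⟩
  rw [map_mul, hb, Units.val_mul, hy]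
  ring

section CommonDenominators

variable [IsDomain D] [IsFractionRing D F]

variable (F) in
lemma exists_common_denominator {ι : Type*} [Finite ι] (f : ι → F) :
    ∃ (z : Fˣ) (t : D), (z : F) = algebraMap D F t ∧ ∀ i, ∃ b : D, algebraMap D F b = f i * z := by
  obtain ⟨t, ht⟩ := IsLocalization.exist_integer_multiples_of_finite (nonZeroDivisors D) f
  have h0 : algebraMap D F t ≠ 0 := IsFractionRing.to_map_ne_zero_of_mem_nonZeroDivisors t.2
  refine ⟨Units.mk0 _ h0, t, rfl, fun i => ?_⟩
  obtain ⟨b, hb⟩ := ht i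
  refine ⟨b, ?_⟩
  rw [hb, Units.val_mk0, mul_comm, ← Algebra.smul_def]

variable (D) in
-- By surjectivity of `ν`, every box vector is the value of some fraction; `w` is the value of a
-- common denominator.
lemma exists_shift_mem_values (p : ℕ) :
    ∃ w : Fin d → ℤ, ∀ r : Fin d → Fin p,
      (w + fun i => ((r i : ℕ) : ℤ)) ∈ ν.values (⊤ : Ideal D) := by
  choose g hg using fun r : Fin d → Fin p => ν.exists_val_eq fun i => ((r i : ℕ) : ℤ)
  obtain ⟨z, -, -, hz⟩ := exists_common_denominator F (D := D) fun r => (g r : F)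
  refine ⟨ν.val z, fun r => ?_⟩
  obtain ⟨b, hb⟩ := hz r
  refine ⟨b, trivial, g r * z, by rw [hb, Units.val_mul], ?_⟩
  rw [val_mul_eq_add, hg, add_comm]

end CommonDenominators

variable [Algebra D ν.valuationRing] [IsScalarTower D ν.valuationRing F]

variable [IsDomain D] [IsFractionRing D F]

variable (D) in
-- A common denominator `z` of lifts of finitely many generators works: the residue classes attained
-- over `z` form a `D`-submodule.
lemma exists_fills_top [Module.Finite D (IsLocalRing.ResidueField ν.valuationRing)] :
    ∃ z : Fˣ, ν.Fills (⊤ : Ideal D) z := by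
  obtain ⟨s, hs⟩ := Module.Finite.fg_top (R := D)
    (M := IsLocalRing.ResidueField ν.valuationRing)
  choose lift hlift using IsLocalRing.residue_surjective (R := ν.valuationRing)
  obtain ⟨z, -, -, hz⟩ := exists_common_denominator F (D := D) fun c : s => ((lift c : _) : F)
  refine ⟨z, fun c => ?_⟩
  have hc : c ∈ Submodule.span D (s : Set (IsLocalRing.ResidueField ν.valuationRing)) := by
    rw [hs]
    trivial
  induction hc using Submodule.span_induction with
  | mem c hc =>
    obtain ⟨b, hb⟩ := hz ⟨c, hc⟩
    exact ⟨b, trivial, lift c, hlift c, hb⟩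
  | zero => exact ⟨0, trivial, 0, map_zero _, by simp⟩
  | add c c' _ _ h h' =>
    obtain ⟨b, -, v, hv, hb⟩ := h
    obtain ⟨b', -, v', hv', hb'⟩ := h'
    refine ⟨b + b', trivial, v + v', by rw [map_add, hv, hv'], ?_⟩
    rw [map_add, hb, hb', ← add_mul]
    rfl
  | smul r c _ h =>
    obtain ⟨b, -, v, hv, hb⟩ := h
    refine ⟨r * b, trivial, algebraMap D _ r * v, ?_, ?_⟩
    · rw [map_mul, hv, Algebra.smul_def]
      rfl
    · rw [map_mul, hb, IsScalarTower.algebraMap_apply D ν.valuationRing F, ← mul_assoc]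
      rfl

/-- Translated by `ν.val z`, infinitely many such values would be filled and lie below a fixed
weight, forcing a level ideal to have infinite colength. -/
lemma finite_values_lt [Module.Finite D (IsLocalRing.ResidueField ν.valuationRing)]
    (ha : LinearIndependent ℚ a)
    (hfin : ∀ n : ℝ, Module.length D (D ⧸ ν.level D (UpperSet.Ici n)) ≠ ⊤) (I : Ideal D) (n : ℝ) :
    {u ∈ ν.values I | weight a u < n}.Finite := by
  obtain ⟨z, hz⟩ := ν.exists_fills_top D
  by_contra hinf
  set m := n + weight a (ν.val z)
  obtain ⟨t, ht, hcard⟩ := Set.Infinite.exists_subset_card_eq hinf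
    ((Module.length D (D ⧸ ν.level D (UpperSet.Ici m))).toNat + 1)
  classical
  have h := ν.le_length_quotient_inf_level ha (⊤ : Ideal D) (t.image (· + ν.val z)) m (by
    intro u hu
    obtain ⟨w, hw, rfl⟩ := Finset.mem_image.mp hu
    obtain ⟨⟨x, hx, y, hy, rfl⟩, hlt⟩ := ht hw
    refine ⟨by rw [map_add]; exact add_lt_add_left hlt _, y * z, ν.val_mul_eq_add _ _, ?_⟩
    exact ν.fills_mul (I := ⊤) (x := x) trivial hy hz)
  rw [Finset.card_image_of_injective _ (add_left_injective _), hcard] at h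
  have h2 : Module.length D (D ⧸ (⊤ : Ideal D) ⊓ ν.level D (UpperSet.Ici m)) ≤
      Module.length D (D ⧸ ν.level D (UpperSet.Ici m)) :=
    Module.length_quotient_anti (le_inf le_top le_rfl)
  have h3 : (((Module.length D (D ⧸ ν.level D (UpperSet.Ici m))).toNat + 1 : ℕ) : ℕ∞) ≤
      Module.length D (D ⧸ ν.level D (UpperSet.Ici m)) := by
    refine le_trans ?_ (h.trans h2)
    refine le_trans ?_ le_add_self
    exact le_mul_of_one_le_right zero_le (ν.one_le_resLength D)
  rw [← ENat.natCast_toNat (hfin m)] at h3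
  have := Nat.cast_le.mp h3
  simp at this

/-- Lengths of truncations are superadditive along `p`-th powers. -/
lemma exists_length_quotient_inf_level_le
    [Module.Finite D (IsLocalRing.ResidueField ν.valuationRing)]
    (ha : LinearIndependent ℚ a)
    (hfin : ∀ n : ℝ, Module.length D (D ⧸ ν.level D (UpperSet.Ici n)) ≠ ⊤) {p : ℕ} (hp : 0 < p) :
    ∃ c : ℝ, 0 ≤ c ∧ ∀ (I I' : Ideal D) (n n' : ℝ), (∀ x ∈ I, x ^ p ∈ I') → p * n + c ≤ n' →
      ∃ N : ℕ, Module.length D (D ⧸ I ⊓ ν.level D (UpperSet.Ici n)) ≤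
          Module.length D (D ⧸ I) + N * ν.resLength D ∧
        Module.length D (D ⧸ I') + (p ^ d * N : ℕ) * ν.resLength D ≤
          Module.length D (D ⧸ I' ⊓ ν.level D (UpperSet.Ici n')) := by
  classical
  obtain ⟨z, hz⟩ := ν.exists_fills_top D
  obtain ⟨w, hw⟩ := ν.exists_shift_mem_values D p
  obtain ⟨c, hc⟩ := (Set.finite_range fun r : Fin d → Fin p =>
    weight a (w + fun i => ((r i : ℕ) : ℤ)) + weight a (ν.val z)).bddAbove
  -- Here `c` bounds the weight of the correction `w + r + ν.val z` over the finitely many `r`.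
  refine ⟨max c 0, le_max_right _ _, fun I I' n n' hI hn => ?_⟩
  set X := (ν.finite_values_lt ha hfin I n).toFinset with hX
  refine ⟨X.card, ν.length_quotient_inf_level_le I X n fun u hu => ?_, ?_⟩
  · rw [hX, Set.Finite.mem_toFinset]
    rcases lt_or_ge (weight a u) n with h | h
    · exact Or.inl ⟨hu, h⟩
    · exact Or.inr h
  -- The vector `p u + r + w + ν.val z` is filled in `I'` by the products `x ^ p * b * b'`: `x ∈ I`
  -- has value `u`, `b` has value `w + r`, and the elements `b'` fill `z`. Division by `p` with
  -- remainder separates these vectors.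
  · set Y := ((X ×ˢ (Finset.univ : Finset (Fin d → Fin p))).image fun x =>
      p • x.1 + fun i => ((x.2 i : ℕ) : ℤ)).image (· + (w + ν.val z)) with hY
    have hcard : Y.card = p ^ d * X.card := by
      rw [hY, Finset.card_image_of_injective _ (add_left_injective _),
        Finset.card_image_of_injective _ mul_add_fin_injective, Finset.card_product,
        Finset.card_univ, Fintype.card_fun, Fintype.card_fin, Fintype.card_fin, mul_comm]
    rw [← hcard]
    refine ν.le_length_quotient_inf_level ha I' Y n' fun v hv => ?_
    obtain ⟨_, hv', rfl⟩ := Finset.mem_image.mp hv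
    obtain ⟨⟨u, r⟩, hu, rfl⟩ := Finset.mem_image.mp hv'
    rw [Finset.mem_product, hX, Set.Finite.mem_toFinset] at hu
    obtain ⟨⟨x, hx, y, hy, rfl⟩, hlt⟩ := hu.1
    obtain ⟨b, -, g, hg, hgv⟩ := hw r
    have e : (p • ν.val y + fun i => ((r i : ℕ) : ℤ)) + (w + ν.val z) =
        p • ν.val y + (w + fun i => ((r i : ℕ) : ℤ)) + ν.val z := by abel
    refine ⟨?_, y ^ p * g * z, ?_, ?_⟩
    · have h1 := hc ⟨r, rfl⟩
      dsimp only at h1 hlt ⊢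
      rw [e, map_add, map_add, map_nsmul, nsmul_eq_mul]
      have h2 : (p : ℝ) * weight a (ν.val y) < p * n :=
        mul_lt_mul_of_pos_left hlt (by exact_mod_cast hp)
      have h3 := le_max_left c 0
      linarith
    · rw [val_mul_eq_add, val_mul_eq_add, val_pow_eq_nsmul, hgv, e]
    · refine ν.fills_mul (x := x ^ p * b) (I'.mul_mem_right _ (hI x hx)) ?_ hz
      rw [Units.val_mul, Units.val_pow_eq_pow_val, hy, hg, map_mul, map_pow]

end LatticeValuation
end OKVol

/-! ### Convergence for OK domains. -/

lemma Module.length_quotient_inf_le {R M : Type*} [CommRing R] [AddCommGroup M] [Module R M]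
    (A B : Submodule R M) : Module.length R (M ⧸ A ⊓ B) ≤
      Module.length R (M ⧸ A) + Module.length R (M ⧸ B) :=
  Module.length_quotient_le_add inf_le_left (B.mkQ ∘ₗ A.subtype) fun x => by simp

/-- A sequence that grows at least and at most like `q ^ d`, with `q = p ^ e`, has a limit after
division by `q ^ d`. -/
lemma exists_tendsto_div_pow_of_mul_le {p d : ℕ} (hp : 0 < p) (L : ℕ → ℝ) (C : ℝ)
    (hL : ∀ e, (p : ℝ) ^ d * L e ≤ L (e + 1)) (hC : ∀ e, L e ≤ C * ((p : ℝ) ^ e) ^ d) :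
    ∃ l, Filter.Tendsto (fun e => L e / ((p : ℝ) ^ e) ^ d) Filter.atTop (𝓝 l) := by
  have hp' : (0 : ℝ) < p := by exact_mod_cast hp
  refine ⟨_, tendsto_atTop_ciSup (monotone_nat_of_le_succ fun e => ?_) ⟨C, ?_⟩⟩
  · rw [div_le_div_iff₀ (by positivity) (by positivity)]
    calc L e * ((p : ℝ) ^ (e + 1)) ^ d = (p : ℝ) ^ d * L e * ((p : ℝ) ^ e) ^ d := by ring
      _ ≤ _ := by
        gcongr
        exact hL e
  · rintro _ ⟨e, rfl⟩
    exact (div_le_iff₀ (by positivity)).mpr (hC e)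

namespace OKVol

lemma pow_pow_mem_of_forall_pow_mem {R : Type*} [CommRing R] {p : ℕ} {I : ℕ → Ideal R}
    (hI : ∀ e, ∀ x ∈ I e, x ^ p ∈ I (e + 1)) (e : ℕ) : ∀ x ∈ I 0, x ^ p ^ e ∈ I e := by
  induction e with
  | zero => simp
  | succ e ih =>
    intro x hx
    rw [pow_succ, pow_mul]
    exact hI e _ (ih x hx)

/-- With `s` generators, `I₀ ^ (s * q + 1)` lies in the ideal of `q`-th powers of the generators;
positivity of `q` makes `k = s + 1` suffice, uniformly in `q`. -/
lemma exists_pow_le_of_forall_pow_mem {R : Type*} [CommRing R] [IsNoetherianRing R]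
    (I₀ : Ideal R) : ∃ k : ℕ, ∀ (q : ℕ) (J : Ideal R), 0 < q → (∀ x ∈ I₀, x ^ q ∈ J) →
      I₀ ^ (k * q) ≤ J := by
  obtain ⟨s, hs⟩ := IsNoetherian.noetherian I₀
  refine ⟨s.card + 1, fun q J hq hJ => ?_⟩
  have h1 : s.card * q + 1 ≤ (s.card + 1) * q := by
    rw [add_mul, one_mul]
    lia
  refine (Ideal.pow_le_pow_right h1).trans ?_
  have h2 := Ideal.span_finset_pow_le s q
  rw [show Ideal.span (s : Set R) = I₀ from hs] at h2
  refine h2.trans (Ideal.span_le.mpr ?_)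
  rintro _ ⟨x, hx, rfl⟩
  exact hJ x (hs ▸ Submodule.subset_span hx)

namespace LatticeValuation

variable {F : Type*} [Field F] {d : ℕ} {a : Fin d → ℝ} (ν : LatticeValuation F d a)
  {D : Type*} [CommRing D] [Algebra D F] [Algebra D ν.valuationRing]
  [IsScalarTower D ν.valuationRing F]

lemma level_Ici_anti {s t : ℝ} (h : s ≤ t) :
    ν.level D (UpperSet.Ici t) ≤ ν.level D (UpperSet.Ici s) :=
  fun _ hx y hy => h.trans (ν.mem_level_Ici.mp hx y hy)

lemma mul_mem_level {s t : ℝ} {x x' : D} (hx : x ∈ ν.level D (UpperSet.Ici s))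
    (hx' : x' ∈ ν.level D (UpperSet.Ici t)) : x * x' ∈ ν.level D (UpperSet.Ici (s + t)) := by
  rw [mem_level_Ici] at hx hx' ⊢
  intro y hy
  rw [map_mul] at hy
  have h0 : algebraMap D F x * algebraMap D F x' ≠ 0 := hy ▸ y.ne_zero
  have e : y = Units.mk0 _ (left_ne_zero_of_mul h0) * Units.mk0 _ (right_ne_zero_of_mul h0) :=
    Units.ext (by simpa using hy)
  rw [e, weight_val_mul]
  exact add_le_add (hx _ rfl) (hx' _ rfl)

lemma pow_level_le (t : ℝ) (n : ℕ) :
    ν.level D (UpperSet.Ici t) ^ n ≤ ν.level D (UpperSet.Ici (n * t)) := by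
  induction n with
  | zero =>
    intro x _ y hy
    rw [Nat.cast_zero, zero_mul]
    exact ν.mem_valuationRing_iff.mp (ν.algebraMap_mem_valuationRing x) y hy
  | succ n ih =>
    rw [pow_succ, Ideal.mul_le]
    intro x hx y hy
    have := ν.mul_mem_level (ih hx) hy
    rwa [Nat.cast_succ, add_mul, one_mul]

section Local

variable [IsLocalRing D] [IsNoetherianRing D] [IsLocalHom (algebraMap D ν.valuationRing)]

/-- Domination gives the generators of the maximal ideal positive weight; finitely many of them
leave a uniform bound. -/
lemma exists_pos_maximalIdeal_le_level :
    ∃ δ : ℝ, 0 < δ ∧ IsLocalRing.maximalIdeal D ≤ ν.level D (UpperSet.Ici δ) := by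
  classical
  obtain ⟨s, hs⟩ := IsNoetherian.noetherian (IsLocalRing.maximalIdeal D)
  rw [← hs]
  have key : ∀ x ∈ IsLocalRing.maximalIdeal D, ∀ y : Fˣ, (y : F) = algebraMap D F x →
      0 < weight a (ν.val y) := by
    intro x hx
    have h : IsLocalRing.residue ν.valuationRing (algebraMap D _ x) = 0 := by
      rw [IsLocalRing.residue_eq_zero_iff]
      exact map_nonunit (algebraMap D ν.valuationRing) x hx
    rw [residue_eq_zero_iff] at h
    intro y hy
    exact h y (by rw [hy, IsScalarTower.algebraMap_apply D ν.valuationRing F]; rfl)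
  have hsub : ∀ x ∈ s, x ∈ IsLocalRing.maximalIdeal D := fun x hx => hs ▸ Submodule.subset_span hx
  clear hs
  induction s using Finset.induction_on with
  | empty => exact ⟨1, one_pos, by simp⟩
  | insert x s _ ih =>
    obtain ⟨δ, hδ, hle⟩ := ih fun y hy => hsub y (Finset.mem_insert_of_mem hy)
    obtain ⟨ε, hε, hx⟩ : ∃ ε > 0, x ∈ ν.level D (UpperSet.Ici ε) := by
      by_cases h0 : algebraMap D F x = 0
      · exact ⟨1, one_pos, fun y hy => absurd (hy.trans h0) y.ne_zero⟩
      · refine ⟨_, key x (hsub x (Finset.mem_insert_self _ _)) (Units.mk0 _ h0) rfl,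
          fun y hy => ?_⟩
        rw [show y = Units.mk0 _ h0 from Units.ext hy]
        exact le_refl (weight a _)
    refine ⟨min δ ε, lt_min hδ hε, ?_⟩
    rw [Finset.coe_insert, Submodule.span_insert, sup_le_iff, Submodule.span_singleton_le_iff_mem]
    exact ⟨ν.level_Ici_anti (min_le_right _ _) hx, hle.trans (ν.level_Ici_anti (min_le_left _ _))⟩

lemma exists_pow_maximalIdeal_le_level (t : ℝ) :
    ∃ N : ℕ, IsLocalRing.maximalIdeal D ^ N ≤ ν.level D (UpperSet.Ici t) := by
  obtain ⟨δ, hδ, hle⟩ := ν.exists_pos_maximalIdeal_le_level (D := D)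
  obtain ⟨N, hN⟩ := Archimedean.arch t hδ
  rw [nsmul_eq_mul] at hN
  exact ⟨N, (Ideal.pow_right_mono hle N).trans
    ((ν.pow_level_le δ N).trans (ν.level_Ici_anti hN))⟩

lemma length_quotient_level_ne_top (t : ℝ) :
    Module.length D (D ⧸ ν.level D (UpperSet.Ici t)) ≠ ⊤ := by
  obtain ⟨N, hN⟩ := ν.exists_pow_maximalIdeal_le_level (D := D) t
  exact IsLocalRing.length_quotient_ne_top_of_pow_le hN

lemma exists_length_quotient_level_le {k : ℕ} (hk : ringKrullDim D = k) (B : ℝ) :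
    ∃ C : ℕ, ∀ (n : ℕ) (t : ℝ), t ≤ B * n →
      Module.length D (D ⧸ ν.level D (UpperSet.Ici t)) ≤ C * (n : ℕ∞) ^ k := by
  obtain ⟨N, hN⟩ := ν.exists_pow_maximalIdeal_le_level (D := D) B
  obtain ⟨C, hC⟩ := IsLocalRing.exists_length_quotient_le hN hk
  refine ⟨C, fun n t ht => hC n _ fun x hx => ?_⟩
  refine ν.level_Ici_anti ?_ (ν.pow_level_le B n (Ideal.pow_mem_pow hx n))
  rwa [mul_comm]

variable [IsDomain D] [IsFractionRing D F]

/-- The normalized colengths of the truncations of a `p`-family inside the members of the family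
converge, for truncations at height `B q - c`. -/
lemma exists_tendsto_truncation [Module.Finite D (IsLocalRing.ResidueField ν.valuationRing)]
    (ha : LinearIndependent ℚ a) (hd : ringKrullDim D = d) (hκ : ν.resLength D ≠ ⊤)
    {p : ℕ} (hp : 2 ≤ p) :
    ∃ c : ℝ, 0 ≤ c ∧ ∀ (I : ℕ → Ideal D) (B : ℝ), (∀ e, ∀ x ∈ I e, x ^ p ∈ I (e + 1)) →
      (∀ e, Module.length D (D ⧸ I e) ≠ ⊤) →
      ∃ l, Filter.Tendsto (fun e =>
        (((Module.length D (D ⧸ I e ⊓ ν.level D (UpperSet.Ici (B * p ^ e - c)))).toNat : ℝ) -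
          (Module.length D (D ⧸ I e)).toNat) / ((p : ℝ) ^ e) ^ d) Filter.atTop (𝓝 l) := by
  have hp0 : 0 < p := by lia
  obtain ⟨c, hc, H⟩ := ν.exists_length_quotient_inf_level_le ha
    (ν.length_quotient_level_ne_top (D := D)) hp0
  refine ⟨c, hc, fun I B hI hfin => ?_⟩
  obtain ⟨C, hC⟩ := ν.exists_length_quotient_level_le hd B
  have hfin' : ∀ (e : ℕ) (t : ℝ),
      Module.length D (D ⧸ I e ⊓ ν.level D (UpperSet.Ici t)) ≠ ⊤ := fun e t =>
    ne_top_of_le_ne_top (WithTop.add_ne_top.mpr ⟨hfin e, ν.length_quotient_level_ne_top t⟩)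
      (Module.length_quotient_inf_le _ _)
  refine exists_tendsto_div_pow_of_mul_le hp0 _ C (fun e => ?_) fun e => ?_
  -- Lowering the cut by `c` absorbs the shift: the requirement reduces to `2 * c ≤ p * c`.
  · have hn : p * (B * p ^ e - c) + c ≤ B * p ^ (e + 1) - c := by
      have h2 : (2 : ℝ) ≤ p := by exact_mod_cast hp
      have h3 : 2 * c ≤ p * c := mul_le_mul_of_nonneg_right h2 hc
      have h4 : (p : ℝ) * (B * p ^ e - c) = B * p ^ (e + 1) - p * c := by ring
      rw [h4]
      linarith
    obtain ⟨N, h1, h2⟩ := H (I e) (I (e + 1)) _ _ (hI e) hn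
    rw [← ENat.natCast_toNat (hfin e), ← ENat.natCast_toNat (hfin' e _),
      ← ENat.natCast_toNat hκ] at h1
    rw [← ENat.natCast_toNat (hfin (e + 1)), ← ENat.natCast_toNat (hfin' (e + 1) _),
      ← ENat.natCast_toNat hκ] at h2
    have h1' : ((Module.length D (D ⧸ I e ⊓ ν.level D (UpperSet.Ici (B * p ^ e - c)))).toNat : ℝ) ≤
        (Module.length D (D ⧸ I e)).toNat + N * (ν.resLength D).toNat := by exact_mod_cast h1
    have h2' : ((Module.length D (D ⧸ I (e + 1))).toNat : ℝ) +
        p ^ d * N * (ν.resLength D).toNat ≤ (Module.length D (D ⧸ I (e + 1) ⊓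
          ν.level D (UpperSet.Ici (B * p ^ (e + 1) - c)))).toNat := by exact_mod_cast h2
    calc _ ≤ (p : ℝ) ^ d * (N * (ν.resLength D).toNat) := by
          gcongr
          linarith
      _ ≤ _ := by linarith
  · have h1 := Module.length_quotient_inf_le (I e) (ν.level D (UpperSet.Ici (B * p ^ e - c)))
    have h2 := hC (p ^ e) (B * p ^ e - c) (by push_cast; linarith)
    have h3 := h1.trans (add_le_add_right h2 _)
    rw [← ENat.natCast_toNat (hfin e), ← ENat.natCast_toNat (hfin' e _)] at h3
    have h3' : ((Module.length D (D ⧸ I e ⊓ ν.level D (UpperSet.Ici (B * p ^ e - c)))).toNat : ℝ) ≤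
        (Module.length D (D ⧸ I e)).toNat + C * ((p : ℝ) ^ e) ^ d := by exact_mod_cast h3
    linarith

/-- The volume of a `p`-family exists in the presence of a suitable valuation. -/
lemma exists_tendsto_length_quotient
    [Module.Finite D (IsLocalRing.ResidueField ν.valuationRing)]
    (ha : LinearIndependent ℚ a) (hd : ringKrullDim D = d) (hκ : ν.resLength D ≠ ⊤)
    {v : Fin d → ℤ} (hv : ∀ n : ℕ,
      ν.level D (UpperSet.Ici (weight a (n • v))) ≤ IsLocalRing.maximalIdeal D ^ n)
    {p : ℕ} (hp : 2 ≤ p) (I : ℕ → Ideal D) (hI : ∀ e, ∀ x ∈ I e, x ^ p ∈ I (e + 1))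
    {N : ℕ} (hN : IsLocalRing.maximalIdeal D ^ N ≤ I 0) :
    ∃ l, Filter.Tendsto (fun e =>
      ((Module.length D (D ⧸ I e)).toNat : ℝ) / ((p : ℝ) ^ e) ^ d) Filter.atTop (𝓝 l) := by
  obtain ⟨c, hc, H⟩ := ν.exists_tendsto_truncation ha hd hκ hp
  obtain ⟨k, hk⟩ := exists_pow_le_of_forall_pow_mem (I 0)
  have hq : ∀ e, 0 < p ^ e := fun e => Nat.pow_pos (by lia)
  have hle : ∀ e, IsLocalRing.maximalIdeal D ^ (N * (k * p ^ e)) ≤ I e := fun e => by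
    rw [pow_mul]
    exact (Ideal.pow_right_mono hN _).trans
      (hk _ _ (hq e) (pow_pow_mem_of_forall_pow_mem hI e))
  -- With `q = p ^ e ≥ 1`, this gives `B * q - c ≥ N * k * q * weight a v`, so the cut lies in the
  -- `(N * k * q)`-th power of the maximal ideal and hence in `I e`.
  set B : ℝ := |N * k * weight a v| + c with hB
  have hlev : ∀ e, ν.level D (UpperSet.Ici (B * p ^ e - c)) ≤ I e := fun e => by
    refine (ν.level_Ici_anti ?_).trans ((hv (N * (k * p ^ e))).trans (hle e))
    rw [map_nsmul, nsmul_eq_mul]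
    have h1 : (1 : ℝ) ≤ p ^ e := by exact_mod_cast hq e
    have h2 := le_abs_self (N * k * weight a v)
    have h3 : c * 1 ≤ c * p ^ e := mul_le_mul_of_nonneg_left h1 hc
    have h4 : N * k * weight a v * (p : ℝ) ^ e ≤ |N * k * weight a v| * (p : ℝ) ^ e :=
      mul_le_mul_of_nonneg_right h2 (by positivity)
    push_cast
    rw [hB, add_mul]
    linarith
  obtain ⟨l, hl⟩ := H I B hI fun e => IsLocalRing.length_quotient_ne_top_of_pow_le (hle e)
  -- Both families are truncated by the same level ideal, so its colength cancels in the difference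
  -- and the length of `D / I e` remains.
  obtain ⟨l', hl'⟩ := H (fun _ => ⊤) B (fun _ _ _ => trivial) fun e => by
    rw [Module.length_eq_zero]
    exact ENat.zero_ne_top
  refine ⟨l' - l, (hl'.sub hl).congr fun e => ?_⟩
  rw [← sub_div]
  congr 1
  rw [inf_eq_right.mpr (hlev e), top_inf_eq, Module.length_eq_zero (M := D ⧸ (⊤ : Ideal D))]
  simp

end Local

end LatticeValuation

/-- The volume of a `p`-family in an OK domain exists. -/
lemma IsOKDomain.exists_tendsto {D : Type*} [CommRing D] [IsLocalRing D] (hD : IsOKDomain D)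
    {p : ℕ} (hp : 2 ≤ p) (I : ℕ → Ideal D) (hI : ∀ e, ∀ x ∈ I e, x ^ p ∈ I (e + 1))
    {N : ℕ} (hN : IsLocalRing.maximalIdeal D ^ N ≤ I 0) {k : ℕ} (hk : ringKrullDim D = k) :
    ∃ l, Filter.Tendsto (fun e =>
      ((Module.length D (D ⧸ I e)).toNat : ℝ) / ((p : ℝ) ^ e) ^ k) Filter.atTop (𝓝 l) := by
  obtain ⟨_, _, _, d, a, ν, hd, ha, hν⟩ := hD
  obtain rfl : k = d := by
    rw [hk] at hd
    exact_mod_cast hd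
  let : Algebra D ν.valuationRing := RingHom.toAlgebra
    ((algebraMap D (FractionRing D)).codRestrict ν.valuationRing.toSubring hν.mem_valuationRing)
  have : IsScalarTower D ν.valuationRing (FractionRing D) := .of_algebraMap_eq fun _ => rfl
  have : IsLocalHom (algebraMap D ν.valuationRing) := hν.isLocalHom
  have : Module.Finite (IsLocalRing.ResidueField D) (IsLocalRing.ResidueField ν.valuationRing) := by
    have h : (algebraMap (IsLocalRing.ResidueField D)
        (IsLocalRing.ResidueField ν.valuationRing)).Finite := by
      convert hν.finite_residueField using 1
      ext x
      obtain ⟨x, rfl⟩ := IsLocalRing.residue_surjective x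
      rfl
    exact RingHom.finite_algebraMap.mp h
  have : Module.Finite D (IsLocalRing.ResidueField D) :=
    Module.Finite.of_surjective (Algebra.linearMap D (IsLocalRing.ResidueField D))
      IsLocalRing.residue_surjective
  have : Module.Finite D (IsLocalRing.ResidueField ν.valuationRing) :=
    Module.Finite.trans (IsLocalRing.ResidueField D) _
  have hκ : ν.resLength D ≠ ⊤ := by
    rw [LatticeValuation.resLength, Module.length_eq_of_surjective
      (R := IsLocalRing.ResidueField D) IsLocalRing.residue_surjective, Module.length_eq_finrank]
    exact ENat.natCast_ne_top _
  obtain ⟨v, hv⟩ := hν.exists_vector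
  exact ν.exists_tendsto_length_quotient ha hd hκ (fun n x hx => hv n x hx) hp I hI hN

end OKVol

/-! ### Comparing a reduced ring with its components. -/

section MinimalPrimes

variable {R : Type*} [CommRing R]

lemma Ideal.length_quotient_quotient_map (J I : Ideal R) :
    Module.length (R ⧸ J) ((R ⧸ J) ⧸ I.map (Ideal.Quotient.mk J)) =
      Module.length R (R ⧸ J ⊔ I) := by
  rw [← Module.length_eq_of_surjective (R := R ⧸ J) (S := R) Ideal.Quotient.mk_surjective]
  exact (DoubleQuot.quotQuotEquivQuotSupₐ R J I).toLinearEquiv.length_eq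

/-- Elements `c i` of a reduced ring that vanish on all but one of the components. -/
lemma exists_component_separators {ι : Type*} [Fintype ι] (P : ι → Ideal R)
    (hprime : ∀ i, (P i).IsPrime) (hP : ∀ i j, P i ≤ P j → i = j) (hinf : ⨅ i, P i = ⊥) :
    ∃ c : ι → R, (∀ i, ∀ x ∈ P i, c i * x = 0) ∧ ∑ i, c i ∈ nonZeroDivisors R ∧
      ∀ i j, i ≠ j → c i ∈ P j := by
  classical
  have hzero : ∀ x : R, (∀ i, x ∈ P i) → x = 0 := fun x hx => by
    rw [← Ideal.mem_bot, ← hinf]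
    exact (Submodule.mem_iInf _).mpr hx
  have hex : ∀ i, ∃ c, c ∉ P i ∧ ∀ j, i ≠ j → c ∈ P j := by
    intro i
    -- A prime containing the product would contain some factor, against incomparability.
    have h : ¬ ∏ j ∈ Finset.univ.erase i, P j ≤ P i := by
      rw [(hprime i).prod_le]
      rintro ⟨j, hj, hle⟩
      exact (Finset.mem_erase.mp hj).1 (hP j i hle)
    obtain ⟨c, hc, hci⟩ := SetLike.not_le_iff_exists.mp h
    refine ⟨c, hci, fun j hij => ?_⟩
    exact Ideal.prod_le_inf.trans (Finset.inf_le (Finset.mem_erase.mpr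
      ⟨hij.symm, Finset.mem_univ j⟩)) hc
  choose c hc hcj using hex
  refine ⟨c, fun i x hx => hzero _ fun j => ?_, ?_, hcj⟩
  · by_cases hij : i = j
    · exact hij ▸ (P i).mul_mem_left _ hx
    · exact (P j).mul_mem_right _ (hcj i j hij)
  · rw [mem_nonZeroDivisors_iff_right]
    intro x hx
    refine hzero x fun j => ?_
    have h1 : x * ∑ i, c i ∈ P j := hx ▸ (P j).zero_mem
    refine ((hprime j).mem_or_mem h1).resolve_right fun h2 => hc j ?_
    rw [← Finset.add_sum_erase _ _ (Finset.mem_univ j)] at h2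
    refine ((P j).add_mem_iff_left (Ideal.sum_mem _ fun i hi => ?_)).mp h2
    exact hcj i j (Finset.mem_erase.mp hi).1

lemma sup_le_comap_mulLeft {P : Ideal R} {c : R} (hc : ∀ x ∈ P, c * x = 0) (J : Ideal R) :
    P ⊔ J ≤ Submodule.comap (LinearMap.mulLeft R c) J :=
  sup_le (fun x hx => by
    show c * x ∈ J
    rw [hc x hx]
    exact J.zero_mem) fun x hx => J.mul_mem_left _ hx

variable {ι : Type*} [Fintype ι] (P : ι → Ideal R) (c : ι → R)

/-- The map `(z_i) ↦ ∑ c_i z_i` into `R / J` is well defined because `c_i` kills `P_i`; on the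
diagonal it is multiplication by `∑ c_i`. -/
lemma length_quotient_le_sum_add (hc : ∀ i, ∀ x ∈ P i, c i * x = 0) (J : Ideal R) :
    Module.length R (R ⧸ J) ≤
      ∑ i, Module.length R (R ⧸ P i ⊔ J) +
        Module.length R (R ⧸ Ideal.span {∑ i, c i} ⊔ J) := by
  rw [← Module.length_pi_of_fintype]
  refine Module.length_le_add_of_ker_le_range
    (∑ i, (Submodule.mapQ (P i ⊔ J) J _ (sup_le_comap_mulLeft (hc i) J)) ∘ₗ LinearMap.proj i)
    (Submodule.factor (le_sup_right : J ≤ Ideal.span {∑ i, c i} ⊔ J)) ?_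
  intro z hz
  obtain ⟨z, rfl⟩ := Submodule.Quotient.mk_surjective _ z
  have hz' : z ∈ Ideal.span {∑ i, c i} ⊔ J := Ideal.Quotient.eq_zero_iff_mem.mp (by simpa using hz)
  obtain ⟨_, hw, j, hj, rfl⟩ := Submodule.mem_sup.mp hz'
  obtain ⟨r, rfl⟩ := Ideal.mem_span_singleton'.mp hw
  refine ⟨fun i => Submodule.Quotient.mk r, ?_⟩
  simp only [LinearMap.coe_sum, Finset.sum_apply, LinearMap.comp_apply, LinearMap.proj_apply,
    Submodule.mapQ_apply, LinearMap.mulLeft_apply]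
  change ∑ i, J.mkQ (c i * r) = J.mkQ (r * ∑ i, c i + j)
  rw [← map_sum, map_add, ← Finset.sum_mul, mul_comm r]
  exact (add_eq_left.mpr ((Submodule.Quotient.mk_eq_zero J).mpr hj)).symm

/-- The tuple `(r_i ∑ c)` comes from the single element `∑ r_i c_i`, since modulo `P_j` only the
`j`-th terms survive. So the diagonal map from `R / J` covers everything vanishing modulo `∑ c`. -/
lemma sum_length_quotient_le_add (hc : ∀ i j, i ≠ j → c i ∈ P j) (J : Ideal R) :
    ∑ i, Module.length R (R ⧸ P i ⊔ J) ≤ Module.length R (R ⧸ J) +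
      Fintype.card ι * Module.length R (R ⧸ Ideal.span {∑ i, c i} ⊔ J) := by
  classical
  have h1 : Module.length R (Π i, R ⧸ P i ⊔ (Ideal.span {∑ i, c i} ⊔ J)) ≤
      Fintype.card ι * Module.length R (R ⧸ Ideal.span {∑ i, c i} ⊔ J) := by
    rw [Module.length_pi_of_fintype, ← nsmul_eq_mul, ← Finset.card_univ]
    exact Finset.sum_le_card_nsmul _ _ _ fun i _ => Module.length_quotient_anti le_sup_right
  refine le_trans ?_ (add_le_add_right h1 _)
  rw [← Module.length_pi_of_fintype]
  refine Module.length_le_add_of_ker_le_range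
    (LinearMap.pi fun i => Submodule.factor (le_sup_right : J ≤ P i ⊔ J))
    (LinearMap.pi fun i => Submodule.factor (sup_le_sup le_rfl le_sup_right :
      P i ⊔ J ≤ P i ⊔ (Ideal.span {∑ i, c i} ⊔ J)) ∘ₗ LinearMap.proj i) ?_
  intro z hz
  have hz' : ∀ i, ∃ r : R, Submodule.Quotient.mk (r * ∑ i, c i) = z i := by
    intro i
    obtain ⟨x, hx⟩ := Submodule.Quotient.mk_surjective _ (z i)
    have h0 : Submodule.factor (sup_le_sup le_rfl le_sup_right :
      P i ⊔ J ≤ P i ⊔ (Ideal.span {∑ i, c i} ⊔ J)) (z i) = 0 := congrFun hz i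
    rw [← hx] at h0
    have hx' : x ∈ P i ⊔ (Ideal.span {∑ i, c i} ⊔ J) :=
      Ideal.Quotient.eq_zero_iff_mem.mp (by simpa using h0)
    rw [sup_left_comm] at hx'
    obtain ⟨_, hw, j, hj, rfl⟩ := Submodule.mem_sup.mp hx'
    obtain ⟨r, rfl⟩ := Ideal.mem_span_singleton'.mp hw
    refine ⟨r, ?_⟩
    rw [← hx, Submodule.Quotient.eq, sub_add_cancel_left]
    exact neg_mem hj
  choose r hr using hz'
  refine ⟨Submodule.Quotient.mk (∑ i, r i * c i), funext fun j => ?_⟩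
  rw [← hr j]
  change Submodule.Quotient.mk (∑ i, r i * c i) = _
  rw [Submodule.Quotient.eq, Finset.mul_sum, ← Finset.sum_sub_distrib]
  refine Ideal.mem_sup_left (Ideal.sum_mem _ fun i _ => ?_)
  rw [← sub_mul]
  by_cases hij : i = j
  · rw [hij, sub_self, zero_mul]
    exact (P j).zero_mem
  · exact (P j).mul_mem_left _ (hc i j hij)

end MinimalPrimes

/-! ### Negligible terms in smaller dimension. -/

namespace OKVol

lemma natDim_eq {R : Type*} [CommRing R] {d : ℕ} (h : ringKrullDim R = d) : natDim R = d := by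
  rw [natDim, h]
  rfl

lemma exists_ringKrullDim_eq_natCast (R : Type*) [CommRing R] [FiniteRingKrullDim R] :
    ∃ d : ℕ, ringKrullDim R = d := by
  obtain ⟨n, hn⟩ := WithBot.ne_bot_iff_exists.mp (ringKrullDim_ne_bot (R := R))
  have htop : n ≠ ⊤ := by
    rintro rfl
    exact ringKrullDim_ne_top hn.symm
  exact ⟨n.toNat, by rw [← hn, ← WithBot.coe_natCast, ENat.natCast_toNat htop]⟩

section Asymptotics

variable {R : Type*} [CommRing R] [IsLocalRing R] [IsNoetherianRing R]

/-- In quotients of smaller dimension the lengths are of smaller order. -/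
lemma tendsto_length_quotient_zero {p : ℕ} (hp : 2 ≤ p) {I : ℕ → Ideal R}
    (hI : ∀ e, ∀ x ∈ I e, x ^ p ∈ I (e + 1)) {N : ℕ} (hN : IsLocalRing.maximalIdeal R ^ N ≤ I 0)
    {d : ℕ} (J : Ideal R) (hJ : ringKrullDim (R ⧸ J) < d) :
    Filter.Tendsto (fun e => ((Module.length R (R ⧸ J ⊔ I e)).toNat : ℝ) / ((p : ℝ) ^ e) ^ d)
      Filter.atTop (𝓝 0) := by
  -- The zero ring has dimension `⊥`, so `hJ` allows it; it arises when the nonzerodivisor is a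
  -- unit, as in dimension zero.
  by_cases hJt : J = ⊤
  · have h0 : ∀ e, Module.length R (R ⧸ J ⊔ I e) = 0 := fun e => by
      have : Subsingleton (R ⧸ J ⊔ I e) :=
        Ideal.Quotient.subsingleton_iff.mpr (by rw [hJt, top_sup_eq])
      exact Module.length_eq_zero
    simp [h0]
  have : Nontrivial (R ⧸ J) := Ideal.Quotient.nontrivial_iff.mpr hJt
  have : IsLocalRing (R ⧸ J) := .of_surjective' _ Ideal.Quotient.mk_surjective
  obtain ⟨k, hk⟩ : ∃ k : ℕ, ringKrullDim (R ⧸ J) = k :=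
    exists_ringKrullDim_eq_natCast _
  have hkd : k < d := by
    rw [hk] at hJ
    exact_mod_cast hJ
  have hN' : IsLocalRing.maximalIdeal (R ⧸ J) ^ N ≤ (I 0).map (Ideal.Quotient.mk J) :=
    (Ideal.pow_right_mono (IsLocalRing.maximalIdeal_quotient_le_map J) N).trans
      ((Ideal.map_pow _ _ _).ge.trans (Ideal.map_mono hN))
  obtain ⟨C, hC⟩ := IsLocalRing.exists_length_quotient_le hN' hk
  have hbound : ∀ e, ((Module.length R (R ⧸ J ⊔ I e)).toNat : ℝ) ≤ C * ((p : ℝ) ^ e) ^ k := by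
    intro e
    have h := hC (p ^ e) ((I e).map (Ideal.Quotient.mk J)) fun x hx => by
      obtain ⟨y, hy, rfl⟩ := (Ideal.mem_map_iff_of_surjective _ Ideal.Quotient.mk_surjective).mp hx
      rw [← map_pow]
      exact Ideal.mem_map_of_mem _ (pow_pow_mem_of_forall_pow_mem hI e y hy)
    rw [Ideal.length_quotient_quotient_map] at h
    have h' : Module.length R (R ⧸ J ⊔ I e) ≤ ((C * (p ^ e) ^ k : ℕ) : ℕ∞) := by exact_mod_cast h
    exact_mod_cast ENat.toNat_le_of_le_natCast h'
  have hp1 : (1 : ℝ) < p := by exact_mod_cast hp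
  have hlim : Filter.Tendsto (fun e : ℕ => (C : ℝ) * ((p : ℝ) ^ e)⁻¹) Filter.atTop (𝓝 0) := by
    simpa using (tendsto_inv_atTop_zero.comp (tendsto_pow_atTop_atTop_of_one_lt hp1)).const_mul
      (C : ℝ)
  refine squeeze_zero (fun e => by positivity) (fun e => ?_) hlim
  have h1 : (1 : ℝ) ≤ (p : ℝ) ^ e := one_le_pow₀ hp1.le
  have h0 : (0 : ℝ) < (p : ℝ) ^ e := by linarith
  rw [div_le_iff₀ (by positivity)]
  obtain ⟨m, rfl⟩ := Nat.exists_eq_add_of_lt hkd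
  refine (hbound e).trans ?_
  have h2 : (C : ℝ) * ((p : ℝ) ^ e)⁻¹ * ((p : ℝ) ^ e) ^ (k + m + 1) =
      C * ((p : ℝ) ^ e) ^ k * ((p : ℝ) ^ e) ^ m := by
    field_simp
    ring
  rw [h2]
  exact le_mul_of_one_le_right (by positivity) (one_le_pow₀ h1)

end Asymptotics

end OKVol

/-! ### Volumes of the components and the additivity formula. -/

namespace OKVol

variable {R : Type*} [CommRing R]

lemma VolumeExists.of_tendsto {p : ℕ} {I : ℕ → Ideal R} {l : ℝ}
    (h : Filter.Tendsto (normalizedLength p R I) Filter.atTop (𝓝 l)) :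
    VolumeExists p R I ∧ volume p R I = l := by
  have e : volume p R I = l := h.limUnder_eq
  refine ⟨?_, e⟩
  rw [VolumeExists, e]
  exact h

lemma mem_topMinimalPrimes [IsNoetherianRing R] {P : Ideal R} :
    P ∈ topMinimalPrimes R ↔ P ∈ minimalPrimes R ∧ ringKrullDim (R ⧸ P) = ringKrullDim R := by
  simp [topMinimalPrimes]

variable [IsLocalRing R]

lemma exists_tendsto_normalizedLength_extend {p : ℕ} (hp : 2 ≤ p) {I : ℕ → Ideal R}
    (hI : ∀ e, ∀ x ∈ I e, x ^ p ∈ I (e + 1)) {N : ℕ} (hN : IsLocalRing.maximalIdeal R ^ N ≤ I 0)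
    {d : ℕ} {P : Ideal R} (hP : IsOKDomain (R ⧸ P)) (hdim : ringKrullDim (R ⧸ P) = d) :
    ∃ l, Filter.Tendsto (fun e => ((Module.length R (R ⧸ P ⊔ I e)).toNat : ℝ) /
      ((p : ℝ) ^ e) ^ d) Filter.atTop (𝓝 l) := by
  have : IsLocalRing (R ⧸ P) := hP.choose_spec.choose
  have hN' : IsLocalRing.maximalIdeal (R ⧸ P) ^ N ≤ extend I P 0 :=
    (Ideal.pow_right_mono (IsLocalRing.maximalIdeal_quotient_le_map P) N).trans
      ((Ideal.map_pow _ _ _).ge.trans (Ideal.map_mono hN))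
  obtain ⟨l, hl⟩ := hP.exists_tendsto hp (extend I P) (fun e x hx => by
    obtain ⟨y, hy, rfl⟩ := (Ideal.mem_map_iff_of_surjective _ Ideal.Quotient.mk_surjective).mp hx
    rw [← map_pow]
    exact Ideal.mem_map_of_mem _ (hI e y hy)) hN' hdim
  refine ⟨l, hl.congr fun e => ?_⟩
  rw [extend, Ideal.length_quotient_quotient_map]

/-- The length of `R / J` and the sum of the lengths of its restrictions to the components of a
reduced ring differ by a multiple of the length of the restriction to a smaller subscheme. -/
lemma exists_abs_length_sub_sum_le [IsNoetherianRing R] [IsReduced R] [Fintype (minimalPrimes R)] :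
    ∃ c ∈ nonZeroDivisors R, ∀ (J : Ideal R) (n : ℕ), IsLocalRing.maximalIdeal R ^ n ≤ J →
      |((Module.length R (R ⧸ J)).toNat : ℝ) -
        ∑ P : minimalPrimes R, ((Module.length R (R ⧸ (P : Ideal R) ⊔ J)).toNat : ℝ)| ≤
      (1 + Fintype.card (minimalPrimes R)) *
        (Module.length R (R ⧸ Ideal.span {c} ⊔ J)).toNat := by
  obtain ⟨c, hc, hc', hcj⟩ := exists_component_separators
    (fun P : minimalPrimes R => (P : Ideal R)) (fun P => P.2.1.1)
    (fun P Q h => Subtype.ext (le_antisymm h (Q.2.2 P.2.1 h))) (by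
      rw [← sInf_eq_iInf']
      exact (Ideal.sInf_minimalPrimes (I := (⊥ : Ideal R))).trans
        (nilradical_eq_zero R))
  refine ⟨∑ i, c i, hc', fun J n hn => ?_⟩
  have hfin : ∀ A : Ideal R, Module.length R (R ⧸ A ⊔ J) ≠ ⊤ := fun A =>
    IsLocalRing.length_quotient_ne_top_of_pow_le (hn.trans le_sup_right)
  have hfin0 : Module.length R (R ⧸ J) ≠ ⊤ := IsLocalRing.length_quotient_ne_top_of_pow_le hn
  have h1 := length_quotient_le_sum_add _ c hc J
  have h2 := sum_length_quotient_le_add _ c hcj J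
  choose len hlen using fun A => ENat.ne_top_iff_exists.mp (hfin A)
  rw [← ENat.natCast_toNat hfin0] at h1 h2
  simp only [← hlen, ENat.toNat_natCast] at h1 h2 ⊢
  have h1' : ((Module.length R (R ⧸ J)).toNat : ℝ) ≤
      ∑ P : minimalPrimes R, (len P : ℝ) +
        len (Ideal.span {∑ i, c i}) := by exact_mod_cast h1
  have h2' : ∑ P : minimalPrimes R, (len P : ℝ) ≤
      (Module.length R (R ⧸ J)).toNat + Fintype.card (minimalPrimes R) *
        len (Ideal.span {∑ i, c i}) := by exact_mod_cast h2
  have h3 : (0 : ℝ) ≤ Fintype.card (minimalPrimes R) *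
      len (Ideal.span {∑ i, c i}) := by positivity
  have h4 : (0 : ℝ) ≤ (len (Ideal.span {∑ i, c i}) : ℝ) := by positivity
  rw [abs_le, add_mul, one_mul]
  constructor <;> linarith

end OKVol

theorem mainTheorem11 {R : Type*} [CommRing R] [IsLocalRing R] [IsNoetherianRing R]
    [IsReduced R] (p : ℕ) [Fact p.Prime] [CharP R p]
    (hOK : ∀ P ∈ minimalPrimes R, OKVol.IsOKDomain (R ⧸ P))
    (I : ℕ → Ideal R) (hI : OKVol.IsPFamily p I)
    (hprim : ∀ e, OKVol.IsMaximalPrimary (I e)) :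
    OKVol.VolumeExists p R I ∧
    (∀ P ∈ OKVol.topMinimalPrimes R, OKVol.VolumeExists p (R ⧸ P) (OKVol.extend I P)) ∧
    OKVol.volume p R I =
      ∑ P ∈ OKVol.topMinimalPrimes R, OKVol.volume p (R ⧸ P) (OKVol.extend I P) := by
  classical
  have hp : 2 ≤ p := (Fact.out : p.Prime).two_le
  have hI' : ∀ e, ∀ x ∈ I e, x ^ p ∈ I (e + 1) := fun e x hx =>
    hI e (Ideal.subset_span ⟨x, hx, rfl⟩)
  have hpow : ∀ e, ∃ N, IsLocalRing.maximalIdeal R ^ N ≤ I e := fun e =>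
    Ideal.exists_pow_le_of_le_radical_of_fg (hprim e).2.ge (IsNoetherian.noetherian _)
  obtain ⟨N, hN⟩ := hpow 0
  obtain ⟨d, hd⟩ := OKVol.exists_ringKrullDim_eq_natCast R
  let := (minimalPrimes.finite_of_isNoetherianRing R).fintype
  set g : Ideal R → ℕ → ℝ := fun P e =>
    ((Module.length R (R ⧸ P ⊔ I e)).toNat : ℝ) / ((p : ℝ) ^ e) ^ d with hg
  have hnorm : ∀ P ∈ OKVol.topMinimalPrimes R,
      OKVol.normalizedLength p (R ⧸ P) (OKVol.extend I P) = g P := fun P hP => by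
    funext e
    rw [OKVol.normalizedLength, OKVol.natDim_eq ((OKVol.mem_topMinimalPrimes.mp hP).2.trans hd),
      OKVol.extend, Ideal.length_quotient_quotient_map]
  have hexists : ∀ P ∈ OKVol.topMinimalPrimes R,
      ∃ l, Filter.Tendsto (g P) Filter.atTop (𝓝 l) := fun P hP =>
    OKVol.exists_tendsto_normalizedLength_extend hp hI' hN
      (hOK P (OKVol.mem_topMinimalPrimes.mp hP).1)
      ((OKVol.mem_topMinimalPrimes.mp hP).2.trans hd)
  have htop : ∀ P ∈ OKVol.topMinimalPrimes R,
      OKVol.VolumeExists p (R ⧸ P) (OKVol.extend I P) := fun P hP => by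
    obtain ⟨l, hl⟩ := hexists P hP
    rw [← hnorm P hP] at hl
    exact (OKVol.VolumeExists.of_tendsto hl).1
  have hlow : ∀ P : minimalPrimes R, (P : Ideal R) ∉ OKVol.topMinimalPrimes R →
      Filter.Tendsto (g P) Filter.atTop (𝓝 0) := fun P hP => by
    refine OKVol.tendsto_length_quotient_zero hp hI' hN P ?_
    rw [← hd]
    exact lt_of_le_of_ne (ringKrullDim_quotient_le _) fun h =>
      hP (OKVol.mem_topMinimalPrimes.mpr ⟨P.2, h⟩)
  have hsum : Filter.Tendsto (fun e => ∑ P : minimalPrimes R, g P e) Filter.atTop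
      (𝓝 (∑ P ∈ OKVol.topMinimalPrimes R, OKVol.volume p (R ⧸ P) (OKVol.extend I P))) := by
    have h1 : Filter.Tendsto (fun e => ∑ P : minimalPrimes R, g P e) Filter.atTop
        (𝓝 (∑ P : minimalPrimes R, if (P : Ideal R) ∈ OKVol.topMinimalPrimes R then
          OKVol.volume p (R ⧸ (P : Ideal R)) (OKVol.extend I P) else 0)) := by
      refine tendsto_finsetSum _ fun P _ => ?_
      split_ifs with h
      · rw [← hnorm P h]
        exact htop P h
      · exact hlow P h
    convert h1 using 2
    rw [← Finset.sum_filter]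
    refine (Finset.sum_bij (fun (P : minimalPrimes R) _ => (P : Ideal R)) ?_ ?_ ?_ ?_).symm
    · exact fun P hP => (Finset.mem_filter.mp hP).2
    · exact fun P _ Q _ h => Subtype.ext h
    · exact fun P hP => ⟨⟨P, (OKVol.mem_topMinimalPrimes.mp hP).1⟩,
        Finset.mem_filter.mpr ⟨Finset.mem_univ _, hP⟩, rfl⟩
    · exact fun _ _ => rfl
  obtain ⟨c, hc, hdiff⟩ := OKVol.exists_abs_length_sub_sum_le (R := R)
  -- A nonzerodivisor lowers the dimension, which makes the error term of `hdiff` negligible.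
  have hcdim : ringKrullDim (R ⧸ Ideal.span {c}) < d := by
    have h := ringKrullDim_quotient_succ_le_of_nonZeroDivisor hc
    rw [hd] at h
    exact lt_of_not_ge fun hge => absurd ((add_le_add_left hge 1).trans h) (by
      rw [not_le]
      exact_mod_cast Nat.lt_succ_self d)
  have hzero := OKVol.tendsto_length_quotient_zero hp hI' hN (Ideal.span {c}) hcdim
  have hmain : Filter.Tendsto (OKVol.normalizedLength p R I) Filter.atTop
      (𝓝 (∑ P ∈ OKVol.topMinimalPrimes R, OKVol.volume p (R ⧸ P) (OKVol.extend I P))) := by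
    have hsub : Filter.Tendsto (fun e => OKVol.normalizedLength p R I e -
        ∑ P : minimalPrimes R, g P e) Filter.atTop (𝓝 0) := by
      refine squeeze_zero_norm (fun e => ?_) (by
        simpa only [mul_zero] using hzero.const_mul (1 + (Fintype.card (minimalPrimes R) : ℝ)))
      obtain ⟨n, hn⟩ := hpow e
      have hp0 : (0 : ℝ) < ((p : ℝ) ^ e) ^ d := by
        have : (0 : ℝ) < p := by exact_mod_cast (by lia : 0 < p)
        positivity
      rw [OKVol.normalizedLength, OKVol.natDim_eq hd, hg, ← Finset.sum_div, ← sub_div,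
        Real.norm_eq_abs, abs_div, abs_of_pos hp0, ← mul_div_assoc]
      gcongr
      exact hdiff (I e) n hn
    simpa using hsub.add hsum
  obtain ⟨h1, h2⟩ := OKVol.VolumeExists.of_tendsto hmain
  exact ⟨h1, htop, h2⟩
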